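/- Let $R$ be a principal ideal domain; all graded modules are non-negatively graded with $R$-free components, differentials have degree $-1$, and the Koszul sign rule is used throughout. Chain coalgebras $C$ are coassociative, counital, coaugmented and connected ($C_0=R\cdot 1$), with $\overline C=\ker\varepsilon$; chain algebras are associative, unital and augmented. A chain Hopf algebra is an augmented chain algebra $H$ with a coassociative comultiplication $\delta:H\to H\otimes H$ that is a morphism of chain algebras and has the augmentation $\varepsilon$ as counit. The cobar construction is $\Omega C=(T(s^{-1}\overline C),d_\Omega)$, where $d_\Omega$ is the derivation with $d_\Omega(s^{-1}c)=-s^{-1}(dc)+\sum(-1)^{|c_1|}s^{-1}c_1|s^{-1}c_2$ for $\Delta(c)=\sum c_1\otimes c_2$, and $s^{-1}$ is set to $0$ on $C_0$; it is augmented by killing words of positive length. A Hirsch coalgebra $(C,\psi)$ is a chain coalgebra $C$ with a comultiplication $\psi$ making $\Omega C$ a chain Hopf algebra. A twisting cochain $t:C\to H$ is a linear map of degree $-1$ with $dt+td=\mu(t\otimes t)\Delta$; it induces the algebra map $\alpha_t:\Omega C\to H$, $\alpha_t(s^{-1}c)=t(c)$. Its Hochschild complex $\mathscr H(t)$ is $C\otimes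 H$ with $$d_t(y\otimes x)=dy\otimes x+(-1)^{|y|}y\otimes dx-\sum(-1)^{|y_1|}y_1\otimes t(y_2)x+\sum(-1)^{(|y_1|-1)(|y_2|+|x|)}y_2\otimes x\,t(y_1),$$ where $\Delta(y)=\sum y_1\otimes y_2$. Let $\mathbf{Twist}_{HH}$ be the category whose objects are triples $((C,\psi),t:C\to H,(H,\delta))$ with $(C,\psi)$ a Hirsch coalgebra, $(H,\delta)$ a chain Hopf algebra and $t$ a twisting cochain. Its morphisms to $((C',\psi'),t',(H',\delta'))$ are the pairs $(f,g)$ of a morphism $f:C\to C'$ of coaugmented chain coalgebras and a morphism $g:H\to H'$ of augmented chain algebras such that $gt=t'f$, $(\Omega f\otimes\Omega f)\psi=\psi'\,\Omega f$ and $(g\otimes g)\delta=\delta' g$. **Theorem.** Let $r\ge 1$. One can assign to every object $((C,\psi),t,(H,\delta))$ of $\mathbf{Twist}_{HH}$ such that 1. $\alpha_t:(\Omega C,\psi)\to(H,\delta)$ is a map of (counital) coalgebras, and 2. $\tau\delta t=\delta t$, where $\tau$ is the symmetry isomorphism of $H\otimes H$, an endomorphism $\widetilde\lambda_r$ of the chain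 complex $\mathscr H(t)$ such that: * $\widetilde\lambda_r(1\otimes w)=1\otimes\lambda_r(w)$ for all $w\in H$, where $\lambda_r=\mu^{(r)}\delta^{(r)}=\mathrm{Id}_H^{*r}$ is the $r$-th power map of $H$; * $(\mathrm{Id}_C\otimes\varepsilon)\circ\widetilde\lambda_r=\mathrm{Id}_C\otimes\varepsilon$; * if $(\Omega C,\psi)$ is primitively generated, in the sense that $\psi(s^{-1}c)=s^{-1}c\otimes 1+1\otimes s^{-1}c$ for every $c\in\overline C$, then $\widetilde\lambda_r=\mathrm{Id}_C\otimes\lambda_r$; * $\widetilde\lambda_r$ is natural: $(f\otimes g)\circ\widetilde\lambda_r=\widetilde\lambda_r\circ(f\otimes g)$ for every morphism $(f,g)$ of $\mathbf{Twist}_{HH}$ between two such objects. -/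

import Mathlib

universe u v w

open TensorProduct DirectSum

noncomputable section

namespace PowerMap

section Graded

variable {R : Type u} [CommRing R]
variable {V : Type v} [AddCommGroup V] [Module R V]
variable {W : Type w} [AddCommGroup W] [Module R W]

/-- The sign operator `x ↦ (-1)^{|x|} x` of a graded module. -/
def sgn (gr : ℕ → Submodule R V) [Decomposition gr] : V →ₗ[R] V :=
  (DirectSum.toModule R ℕ V fun n => ((-1 : R) ^ n) • (gr n).subtype) ∘ₗ
    (decomposeLinearEquiv gr).toLinearMap

theorem sgn_of_mem (gr : ℕ → Submodule R V) [Decomposition gr] {n : ℕ} {x : V} (hx : x ∈ gr n) :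
    sgn gr x = (-1 : R) ^ n • x := by
  have := decomposeLinearEquiv_apply_coe (R := R) gr n ⟨x, hx⟩
  simp only at this
  simp [sgn, this]

/-- The Koszul symmetry `v ⊗ w ↦ (-1)^{|v||w|} w ⊗ v`. -/
def koszul (gr : ℕ → Submodule R V) [Decomposition gr] (gr' : ℕ → Submodule R W)
    [Decomposition gr'] : V ⊗[R] W →ₗ[R] W ⊗[R] V :=
  (TensorProduct.congr (decomposeLinearEquiv gr') (decomposeLinearEquiv gr)).symm.toLinearMap ∘ₗ
    (TensorProduct.gradedComm R (fun n => gr n) (fun n => gr' n)).toLinearMap ∘ₗ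
    (TensorProduct.congr (decomposeLinearEquiv gr) (decomposeLinearEquiv gr')).toLinearMap

theorem koszul_of_mem (gr : ℕ → Submodule R V) [Decomposition gr] (gr' : ℕ → Submodule R W)
    [Decomposition gr'] {m n : ℕ} {x : V} {y : W} (hx : x ∈ gr m) (hy : y ∈ gr' n) :
    koszul gr gr' (x ⊗ₜ y) = (-1 : R) ^ (m * n) • (y ⊗ₜ x) := by
  have h1 := decomposeLinearEquiv_apply_coe (R := R) gr m ⟨x, hx⟩
  have h2 := decomposeLinearEquiv_apply_coe (R := R) gr' n ⟨y, hy⟩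
  simp only at h1 h2
  simp only [koszul, LinearMap.comp_apply, LinearEquiv.coe_coe, TensorProduct.congr_tmul, h1, h2]
  rw [TensorProduct.gradedComm_of_tmul_of, Units.smul_def, ← Int.cast_smul_eq_zsmul R, map_smul,
    TensorProduct.congr_symm_tmul]
  simp [mul_comm]

/-- The degree `n` part of the tensor product of two graded modules. -/
def tensorGr (gr : ℕ → Submodule R V) (gr' : ℕ → Submodule R W) (n : ℕ) :
    Submodule R (V ⊗[R] W) :=
  Submodule.span R {z | ∃ i j, i + j = n ∧ ∃ x ∈ gr i, ∃ y ∈ gr' j, x ⊗ₜ[R] y = z}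

/-- The differential `x ⊗ y ↦ dx ⊗ y + (-1)^{|x|} x ⊗ dy` of a tensor product. -/
def tensorD (gr : ℕ → Submodule R V) [Decomposition gr] (d : V →ₗ[R] V) (d' : W →ₗ[R] W) :
    V ⊗[R] W →ₗ[R] V ⊗[R] W :=
  TensorProduct.map d LinearMap.id + TensorProduct.map (sgn gr) d'

/-- The degree `n` part of the tensor algebra on a graded module, spanned by the words in
homogeneous letters whose degrees add up to `n`. -/
def wordGr (gr : ℕ → Submodule R V) (n : ℕ) : Submodule R (TensorAlgebra R V) :=
  Submodule.span R {x | ∃ l : List (Σ i, gr i), (l.map Sigma.fst).sum = n ∧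
    (l.map fun a => TensorAlgebra.ι R (a.2 : V)).prod = x}

theorem ι_mem_wordGr (gr : ℕ → Submodule R V) {n : ℕ} {x : V} (hx : x ∈ gr n) :
    TensorAlgebra.ι R x ∈ wordGr gr n :=
  Submodule.subset_span ⟨[⟨n, ⟨x, hx⟩⟩], by simp, by simp⟩

instance (gr : ℕ → Submodule R V) : SetLike.GradedMonoid (wordGr gr) where
  one_mem := Submodule.subset_span ⟨[], by simp, by simp⟩
  mul_mem := by
    intro i j x y hx hy
    refine (Submodule.mul_le.2 ?_ : wordGr gr i * wordGr gr j ≤ _) (Submodule.mul_mem_mul hx hy)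
    clear hx hy x y
    intro x hx y hy
    have := Submodule.mul_mem_mul hx hy
    rw [wordGr, wordGr, Submodule.span_mul_span] at this
    refine (Submodule.span_mono ?_) this
    rintro _ ⟨_, ⟨l, hl, rfl⟩, _, ⟨l', hl', rfl⟩, rfl⟩
    exact ⟨l ++ l', by simp [hl, hl'], by simp⟩

/-- Auxiliary map for the grading of the tensor algebra on a graded module. -/
def wordDecomp (gr : ℕ → Submodule R V) [Decomposition gr] :
    TensorAlgebra R V →ₐ[R] ⨁ n, wordGr gr n :=
  TensorAlgebra.lift R
    ((DirectSum.toModule R ℕ (⨁ n, wordGr gr n) fun n =>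
      DirectSum.lof R ℕ (fun n => wordGr gr n) n ∘ₗ
        ((TensorAlgebra.ι R).restrict fun _ hx => ι_mem_wordGr gr hx)) ∘ₗ
      (decomposeLinearEquiv gr).toLinearMap)

theorem wordDecomp_ι (gr : ℕ → Submodule R V) [Decomposition gr] {n : ℕ} {x : V}
    (hx : x ∈ gr n) : wordDecomp gr (TensorAlgebra.ι R x) =
      DirectSum.of (fun n => wordGr gr n) n ⟨TensorAlgebra.ι R x, ι_mem_wordGr gr hx⟩ := by
  have h1 := decomposeLinearEquiv_apply_coe (R := R) gr n ⟨x, hx⟩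
  simp only at h1
  simp only [wordDecomp, TensorAlgebra.lift_ι_apply, LinearMap.comp_apply, LinearEquiv.coe_coe, h1,
    DirectSum.toModule_lof]
  rfl

instance wordGradedAlgebra (gr : ℕ → Submodule R V) [Decomposition gr] :
    GradedAlgebra (wordGr gr) :=
  GradedAlgebra.ofAlgHom _ (wordDecomp gr)
    (by
      apply TensorAlgebra.hom_ext
      apply decompose_lhom_ext gr
      intro i
      ext x
      simp [wordDecomp_ι gr x.2])
    (by
      rintro n ⟨x, hx⟩
      simp only
      induction hx using Submodule.span_induction with
      | mem x h =>
        obtain ⟨l, hl, rfl⟩ := h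
        subst hl
        induction l with
        | nil => simp; rfl
        | cons a l ih =>
          simp only [List.map_cons, List.prod_cons, map_mul]
          rw [ih, wordDecomp_ι gr a.2.2,
            DirectSum.of_mul_of]
          exact DirectSum.of_eq_of_gradedMonoid_eq (Sigma.subtype_ext rfl rfl)
      | zero => rw [map_zero]; exact (map_zero _).symm
      | add x y hx hy ihx ihy => rw [map_add, ihx, ihy, ← map_add]; rfl
      | smul r x hx ih =>
        rw [map_smul, ih]
        exact ((DirectSum.lof R ℕ (fun n => wordGr gr n) n).map_smul r ⟨x, hx⟩).symm)


/-- Auxiliary algebra map whose upper right entry is the derivation extending `δ`. -/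
def derMatrix (gr : ℕ → Submodule R V) [Decomposition gr] (δ : V →ₗ[R] TensorAlgebra R V) :
    TensorAlgebra R V →ₐ[R] Matrix (Fin 2) (Fin 2) (TensorAlgebra R V) :=
  TensorAlgebra.lift R
    { toFun := fun x => !![TensorAlgebra.ι R (sgn gr x), δ x; 0, TensorAlgebra.ι R x]
      map_add' := fun x y => by
        ext i j
        fin_cases i <;> fin_cases j <;> simp
      map_smul' := fun r x => by
        ext i j
        fin_cases i <;> fin_cases j <;> simp }

/-- The unique linear map `D` on the tensor algebra of `V` with `D v = δ v` for `v` in `V` and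
`D (x y) = (D x) y + (-1)^{|x|} x (D y)`. -/
def oddDer (gr : ℕ → Submodule R V) [Decomposition gr] (δ : V →ₗ[R] TensorAlgebra R V) :
    TensorAlgebra R V →ₗ[R] TensorAlgebra R V :=
  (Matrix.entryLinearMap R (TensorAlgebra R V) (0 : Fin 2) (1 : Fin 2)) ∘ₗ
    (derMatrix gr δ).toLinearMap

section oddDer

variable (gr : ℕ → Submodule R V) [Decomposition gr] (δ : V →ₗ[R] TensorAlgebra R V)

theorem derMatrix_ι (x : V) : derMatrix gr δ (TensorAlgebra.ι R x) =
    !![TensorAlgebra.ι R (sgn gr x), δ x; 0, TensorAlgebra.ι R x] := by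
  simp [derMatrix]

theorem derMatrix_one_zero (x : TensorAlgebra R V) :
    derMatrix gr δ x 1 0 = 0 ∧ derMatrix gr δ x 1 1 = x := by
  induction x using TensorAlgebra.induction with
  | algebraMap r => simp [AlgHom.commutes, Matrix.algebraMap_matrix_apply]
  | ι x => simp [derMatrix_ι]
  | mul a b ha hb => simp [Matrix.mul_apply, ha, hb]
  | add a b ha hb => simp [ha, hb]

theorem derMatrix_zero_zero (x : TensorAlgebra R V) :
    derMatrix gr δ x 0 0 = sgn (wordGr gr) x := by
  have key : ∀ n, ∀ x ∈ wordGr gr n, derMatrix gr δ x 0 0 = (-1 : R) ^ n • x := by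
    intro n x hx
    induction hx using Submodule.span_induction with
    | mem x h =>
      obtain ⟨l, hl, rfl⟩ := h
      subst hl
      induction l with
      | nil => simp
      | cons a l ih =>
        simp [Matrix.mul_apply, ih, derMatrix_ι, derMatrix_one_zero, sgn_of_mem gr a.2.2,
          pow_add, smul_smul, mul_comm]
    | zero => simp
    | add x y _ _ hx hy => simp [hx, hy]
    | smul r x _ hx => rw [map_smul, Matrix.smul_apply, hx, smul_comm]
  have : (Matrix.entryLinearMap R (TensorAlgebra R V) (0 : Fin 2) (0 : Fin 2)) ∘ₗ
    (derMatrix gr δ).toLinearMap = sgn (wordGr gr) := by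
    apply decompose_lhom_ext (wordGr gr)
    intro n
    ext x
    simp [key n x x.2, sgn_of_mem (wordGr gr) x.2]
  exact LinearMap.congr_fun this x

theorem oddDer_ι (x : V) : oddDer gr δ (TensorAlgebra.ι R x) = δ x := by
  simp [oddDer, derMatrix_ι]

theorem oddDer_one : oddDer gr δ 1 = 0 := by
  simp [oddDer]

theorem oddDer_mul (x y : TensorAlgebra R V) :
    oddDer gr δ (x * y) = oddDer gr δ x * y + sgn (wordGr gr) x * oddDer gr δ y := by
  simp [oddDer, Matrix.mul_apply, derMatrix_one_zero, derMatrix_zero_zero, add_comm]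

end oddDer

end Graded

/-- The submodule of elements of degree one less than `n`. -/
def predGr {R : Type u} [CommRing R] {V : Type v} [AddCommGroup V] [Module R V]
    (gr : ℕ → Submodule R V) : ℕ → Submodule R V
  | 0 => ⊥
  | n + 1 => gr n

section predGr

variable {R : Type u} [CommRing R] {A : Type v} [Ring A] [Algebra R A] (gr : ℕ → Submodule R A)
  [SetLike.GradedMonoid gr]

theorem predGr_mul {m n : ℕ} {x y : A} (hx : x ∈ predGr gr m) (hy : y ∈ gr n) :
    x * y ∈ predGr gr (m + n) := by
  rcases m with _ | m
  · have : x = 0 := by simpa [predGr] using hx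
    simp [this]
  · rw [show m + 1 + n = (m + n) + 1 by omega]
    exact SetLike.mul_mem_graded (A := gr) hx hy

theorem mul_predGr {m n : ℕ} {x y : A} (hx : x ∈ gr m) (hy : y ∈ predGr gr n) :
    x * y ∈ predGr gr (m + n) := by
  rcases n with _ | n
  · have : y = 0 := by simpa [predGr] using hy
    simp [this]
  · exact SetLike.mul_mem_graded (A := gr) hx hy

end predGr

/-- A (non-negatively graded) coaugmented, connected chain coalgebra over `R`: a graded coalgebra
with a differential of degree `-1` that is a coderivation, whose degree `0` part is spanned by
the image `one` of `1` under the coaugmentation. -/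
structure ChainCoalg (R : Type u) [CommRing R] where
  carrier : Type v
  [addCommGroup : AddCommGroup carrier]
  [module : Module R carrier]
  [coalgebra : Coalgebra R carrier]
  gr : ℕ → Submodule R carrier
  [decomposition : Decomposition gr]
  comul_mem : ∀ n, ∀ x ∈ gr n, Coalgebra.comul (R := R) x ∈ tensorGr gr gr n
  counit_of_pos : ∀ n, 0 < n → ∀ x ∈ gr n, Coalgebra.counit (R := R) x = 0
  d : carrier →ₗ[R] carrier
  d_mem : ∀ n, ∀ x ∈ gr n, d x ∈ predGr gr n
  d_d : ∀ x, d (d x) = 0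
  comul_d : ∀ x, Coalgebra.comul (R := R) (d x) = tensorD gr d d (Coalgebra.comul (R := R) x)
  counit_d : ∀ x, Coalgebra.counit (R := R) (d x) = 0
  one : carrier
  comul_one : Coalgebra.comul (R := R) one = one ⊗ₜ[R] one
  counit_one : Coalgebra.counit (R := R) one = 1
  connected : gr 0 = Submodule.span R {one}

attribute [instance] ChainCoalg.addCommGroup ChainCoalg.module ChainCoalg.coalgebra
  ChainCoalg.decomposition

/-- A (non-negatively graded) augmented chain algebra over `R`. -/
structure ChainAlg (R : Type u) [CommRing R] where
  carrier : Type v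
  [ring : Ring carrier]
  [algebra : Algebra R carrier]
  gr : ℕ → Submodule R carrier
  [gradedAlgebra : GradedAlgebra gr]
  d : carrier →ₗ[R] carrier
  d_mem : ∀ n, ∀ x ∈ gr n, d x ∈ predGr gr n
  d_d : ∀ x, d (d x) = 0
  d_mul : ∀ x y, d (x * y) = d x * y + sgn gr x * d y
  aug : carrier →ₐ[R] R
  aug_of_pos : ∀ n, 0 < n → ∀ x ∈ gr n, aug x = 0
  aug_d : ∀ x, aug (d x) = 0

attribute [instance] ChainAlg.ring ChainAlg.algebra ChainAlg.gradedAlgebra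

namespace ChainCoalg

variable {R : Type u} [CommRing R] (C : ChainCoalg.{u, v} R)

/-- The coaugmentation coideal of `C`, realized as the kernel of the counit. -/
abbrev bar : Submodule R C.carrier := LinearMap.ker (Coalgebra.counit (R := R) (A := C.carrier))

/-- The projection `c ↦ c - ε(c) 1` of `C` onto its coaugmentation coideal. -/
def toBar : C.carrier →ₗ[R] C.bar :=
  (LinearMap.id - (LinearMap.toSpanSingleton R C.carrier C.one) ∘ₗ Coalgebra.counit).codRestrict _
    fun c => by simp [C.counit_one]

theorem coe_toBar (c : C.carrier) :
    (C.toBar c : C.carrier) = c - Coalgebra.counit (R := R) c • C.one := rfl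

theorem toBar_coe (c : C.bar) : C.toBar c = c := by
  have : Coalgebra.counit (R := R) (c : C.carrier) = 0 := c.2
  ext; simp [coe_toBar, this]

theorem toBar_of_mem_zero {c : C.carrier} (hc : c ∈ C.gr 0) : C.toBar c = 0 := by
  rw [C.connected, Submodule.mem_span_singleton] at hc
  obtain ⟨r, rfl⟩ := hc
  ext
  simp [coe_toBar, C.counit_one]

/-- The grading of the desuspension `s⁻¹ C̄`: its degree `n` part is the degree `n + 1` part of
the coaugmentation coideal. -/
def desuspGr (n : ℕ) : Submodule R C.bar := (C.gr (n + 1)).comap C.bar.subtype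

theorem toBar_mem {n : ℕ} {c : C.carrier} (hc : c ∈ C.gr (n + 1)) : C.toBar c ∈ C.desuspGr n := by
  simpa [desuspGr, coe_toBar, C.counit_of_pos (n + 1) n.succ_pos c hc] using hc

/-- Auxiliary map for the decomposition of the desuspension. -/
def desuspDecomp : C.carrier →ₗ[R] ⨁ n, C.desuspGr n :=
  (DirectSum.toModule R ℕ (⨁ n, C.desuspGr n) fun n => match n with
    | 0 => 0
    | n + 1 => DirectSum.lof R ℕ (fun n => C.desuspGr n) n ∘ₗ
        (C.toBar.restrict fun _ hc => C.toBar_mem hc)) ∘ₗ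
    (decomposeLinearEquiv C.gr).toLinearMap

theorem desuspDecomp_of_mem {n : ℕ} {c : C.carrier} (hc : c ∈ C.gr (n + 1)) :
    C.desuspDecomp c = DirectSum.lof R ℕ (fun n => C.desuspGr n) n ⟨C.toBar c, C.toBar_mem hc⟩ := by
  have h1 := decomposeLinearEquiv_apply_coe (R := R) C.gr (n + 1) ⟨c, hc⟩
  simp only at h1
  simp only [desuspDecomp, LinearMap.comp_apply, LinearEquiv.coe_coe, h1, DirectSum.toModule_lof]
  rfl

theorem desuspDecomp_of_mem_zero {c : C.carrier} (hc : c ∈ C.gr 0) : C.desuspDecomp c = 0 := by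
  have h1 := decomposeLinearEquiv_apply_coe (R := R) C.gr 0 ⟨c, hc⟩
  simp only at h1
  simp only [desuspDecomp, LinearMap.comp_apply, LinearEquiv.coe_coe, h1, DirectSum.toModule_lof]
  rfl

instance desuspDecomposition : Decomposition C.desuspGr :=
  Decomposition.ofLinearMap _ (C.desuspDecomp ∘ₗ C.bar.subtype)
    (by
      have : DirectSum.coeLinearMap C.desuspGr ∘ₗ C.desuspDecomp = C.toBar := by
        apply decompose_lhom_ext C.gr
        rintro (_ | n)
        · ext x
          simp [C.desuspDecomp_of_mem_zero x.2, C.toBar_of_mem_zero x.2]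
        · ext x
          simp [C.desuspDecomp_of_mem x.2]
      ext x
      rw [← LinearMap.comp_assoc, this]
      simp [toBar_coe])
    (by
      ext n x : 2
      simp only [LinearMap.comp_apply, DirectSum.coeLinearMap_lof, Submodule.subtype_apply,
        LinearMap.id_apply]
      have := C.desuspDecomp_of_mem (n := n) x.2
      simpa [toBar_coe] using this)

/-- The map `c ↦ s⁻¹ c` into the tensor algebra on the desuspension of the coaugmentation coideal,
with `s⁻¹ c = 0` for `c` of degree `0`. -/
def sinv : C.carrier →ₗ[R] TensorAlgebra R C.bar := TensorAlgebra.ι R ∘ₗ C.toBar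

/-- The cobar differential on letters,
`s⁻¹ c ↦ - s⁻¹ (d c) + ∑ (-1)^{|c₁|} s⁻¹ c₁ | s⁻¹ c₂`. -/
def cobarDLetter : C.carrier →ₗ[R] TensorAlgebra R C.bar :=
  - C.sinv ∘ₗ C.d + LinearMap.mul' R (TensorAlgebra R C.bar) ∘ₗ
    TensorProduct.map (C.sinv ∘ₗ sgn C.gr) C.sinv ∘ₗ Coalgebra.comul

/-- The cobar differential. -/
def cobarD : TensorAlgebra R C.bar →ₗ[R] TensorAlgebra R C.bar :=
  oddDer C.desuspGr (C.cobarDLetter ∘ₗ C.bar.subtype)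

theorem sinv_one : C.sinv C.one = 0 := by
  have : C.one ∈ C.gr 0 := by rw [C.connected]; exact Submodule.mem_span_singleton_self _
  simp [sinv, C.toBar_of_mem_zero this]

theorem sinv_mem : ∀ n, ∀ c ∈ C.gr n, C.sinv c ∈ predGr (wordGr C.desuspGr) n
  | 0, c, hc => by simp [predGr, sinv, C.toBar_of_mem_zero hc]
  | n + 1, c, hc => ι_mem_wordGr _ (C.toBar_mem hc)


theorem cobarD_sinv (c : C.carrier) : C.cobarD (C.sinv c) = C.cobarDLetter c := by
  have h1 : C.one ∈ C.gr 0 := by rw [C.connected]; exact Submodule.mem_span_singleton_self _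
  have hd : C.d C.one = 0 := by simpa [predGr] using C.d_mem 0 _ h1
  have h2 : C.cobarDLetter C.one = 0 := by
    simp [cobarDLetter, C.comul_one, hd, C.sinv_one]
  simp [cobarD, sinv, oddDer_ι, coe_toBar, h2]

theorem cobarDLetter_mem (n : ℕ) (c : C.carrier) (hc : c ∈ C.gr (n + 1)) :
    C.cobarDLetter c ∈ predGr (wordGr C.desuspGr) n := by
  have h1 : C.sinv (C.d c) ∈ predGr (wordGr C.desuspGr) n := C.sinv_mem _ _ (C.d_mem _ c hc)
  have h2 : ∀ z ∈ tensorGr C.gr C.gr (n + 1),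
      LinearMap.mul' R (TensorAlgebra R C.bar)
        (TensorProduct.map (C.sinv ∘ₗ sgn C.gr) C.sinv z) ∈ predGr (wordGr C.desuspGr) n := by
    intro z hz
    induction hz using Submodule.span_induction with
    | mem z h =>
      obtain ⟨i, j, hij, x, hx, y, hy, rfl⟩ := h
      have hx' := C.sinv_mem _ _ hx
      have hy' := C.sinv_mem _ _ hy
      simp only [TensorProduct.map_tmul, LinearMap.comp_apply, LinearMap.mul'_apply,
        sgn_of_mem C.gr hx, map_smul, smul_mul_assoc]
      apply Submodule.smul_mem
      rcases i with _ | i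
      · have : C.sinv x = 0 := by simpa [predGr] using hx'
        simp [this]
      · obtain rfl : n = i + j := by omega
        exact mul_predGr _ hx' hy'
    | zero => simp
    | add x y _ _ hx hy => simpa only [map_add] using Submodule.add_mem _ hx hy
    | smul r x _ hx => simpa only [map_smul] using Submodule.smul_mem _ r hx
  simp only [cobarDLetter, LinearMap.add_apply, LinearMap.neg_apply, LinearMap.comp_apply]
  exact Submodule.add_mem _ (Submodule.neg_mem _ h1) (h2 _ (C.comul_mem _ c hc))

theorem cobarD_mem (n : ℕ) (x : TensorAlgebra R C.bar) (hx : x ∈ wordGr C.desuspGr n) :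
    C.cobarD x ∈ predGr (wordGr C.desuspGr) n := by
  induction hx using Submodule.span_induction with
  | mem x h =>
    obtain ⟨l, hl, rfl⟩ := h
    subst hl
    induction l with
    | nil => simp [cobarD, oddDer_one]
    | cons a l ih =>
      have ha : C.cobarD (TensorAlgebra.ι R (a.2 : C.bar)) ∈
          predGr (wordGr C.desuspGr) a.1 := by
        simpa [cobarD, oddDer_ι] using C.cobarDLetter_mem a.1 _ a.2.2
      have hl : (l.map fun a => TensorAlgebra.ι R (a.2 : C.bar)).prod ∈
          wordGr C.desuspGr (l.map Sigma.fst).sum := Submodule.subset_span ⟨l, rfl, rfl⟩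
      have ha' := ι_mem_wordGr C.desuspGr a.2.2
      simp only [List.map_cons, List.prod_cons, List.sum_cons]
      rw [cobarD, oddDer_mul, sgn_of_mem (wordGr C.desuspGr) ha', smul_mul_assoc]
      refine Submodule.add_mem _ ?_ (Submodule.smul_mem _ _ ?_)
      · exact predGr_mul _ ha hl
      · exact mul_predGr _ ha' ih
  | zero => simp
  | add x y _ _ hx hy => simpa only [map_add] using Submodule.add_mem _ hx hy
  | smul r x _ hx => simpa only [map_smul] using Submodule.smul_mem _ r hx

theorem aug_cobarD (x : TensorAlgebra R C.bar) :
    TensorAlgebra.algebraMapInv (C.cobarD x) = 0 := by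
  induction x using TensorAlgebra.induction with
  | algebraMap r => simp [Algebra.algebraMap_eq_smul_one, cobarD, oddDer_one]
  | ι x =>
    have h : ∀ z : C.carrier ⊗[R] C.carrier, TensorAlgebra.algebraMapInv
        (LinearMap.mul' R (TensorAlgebra R C.bar)
          (TensorProduct.map (C.sinv ∘ₗ sgn C.gr) C.sinv z)) = 0 := by
      intro z
      induction z using TensorProduct.induction_on with
      | zero => simp
      | tmul x y => simp [sinv, TensorAlgebra.algebraMapInv]
      | add x y hx hy => simp [hx, hy]
    simp [cobarD, oddDer_ι, cobarDLetter, h]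
    simp [sinv, TensorAlgebra.algebraMapInv]
  | mul a b ha hb =>
    have := oddDer_mul C.desuspGr (C.cobarDLetter ∘ₗ C.bar.subtype) a b
    rw [← cobarD] at this
    simp [this, ha, hb]
  | add a b ha hb => simp [ha, hb]

theorem aug_of_pos (n : ℕ) (hn : 0 < n) (x : TensorAlgebra R C.bar)
    (hx : x ∈ wordGr C.desuspGr n) : TensorAlgebra.algebraMapInv x = 0 := by
  induction hx using Submodule.span_induction with
  | mem x h =>
    obtain ⟨l, hl, rfl⟩ := h
    rcases l with _ | ⟨a, l⟩
    · simp at hl; omega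
    · simp [TensorAlgebra.algebraMapInv]
  | zero => simp
  | add x y _ _ hx hy => simp [hx, hy]
  | smul r x _ hx => simp [hx]


theorem sgn_sgn {V : Type v} [AddCommGroup V] [Module R V] (gr : ℕ → Submodule R V)
    [Decomposition gr] : sgn gr ∘ₗ sgn gr = LinearMap.id := by
  apply decompose_lhom_ext gr
  intro n
  ext x
  simp [sgn_of_mem gr x.2, smul_smul, ← pow_add, ← two_mul]

theorem sgn_d {V : Type v} [AddCommGroup V] [Module R V] (gr : ℕ → Submodule R V)
    [Decomposition gr] (d : V →ₗ[R] V) (hd : ∀ n, ∀ x ∈ gr n, d x ∈ predGr gr n) :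
    sgn gr ∘ₗ d = - d ∘ₗ sgn gr := by
  apply decompose_lhom_ext gr
  intro n
  ext x
  have h := hd n x x.2
  rcases n with _ | n
  · have : d x = 0 := by simpa [predGr] using h
    simp [sgn_of_mem gr x.2, this]
  · simp [sgn_of_mem gr x.2, sgn_of_mem gr h, pow_succ]

theorem comul_sgn : Coalgebra.comul ∘ₗ sgn C.gr =
    TensorProduct.map (sgn C.gr) (sgn C.gr) ∘ₗ Coalgebra.comul := by
  apply decompose_lhom_ext C.gr
  intro n
  ext x
  have h : ∀ z ∈ tensorGr C.gr C.gr n,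
      TensorProduct.map (sgn C.gr) (sgn C.gr) z = (-1 : R) ^ n • z := by
    intro z hz
    induction hz using Submodule.span_induction with
    | mem z h =>
      obtain ⟨i, j, rfl, x, hx, y, hy, rfl⟩ := h
      simp [sgn_of_mem C.gr hx, sgn_of_mem C.gr hy, TensorProduct.smul_tmul', smul_smul, pow_add,
        mul_comm]
    | zero => simp
    | add x y _ _ hx hy => simp [hx, hy]
    | smul r x _ hx => rw [map_smul, hx, smul_comm]
  simp [sgn_of_mem C.gr x.2, h _ (C.comul_mem n x x.2)]

theorem sgn_sinv : sgn (wordGr C.desuspGr) ∘ₗ C.sinv = - C.sinv ∘ₗ sgn C.gr := by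
  apply decompose_lhom_ext C.gr
  intro n
  ext x
  have h := C.sinv_mem n x x.2
  rcases n with _ | n
  · have : C.sinv x = 0 := by simpa [predGr] using h
    simp [sgn_of_mem C.gr x.2, this]
  · simp [sgn_of_mem C.gr x.2, sgn_of_mem (wordGr C.desuspGr) h, pow_succ]

theorem cobarD_mul (x y : TensorAlgebra R C.bar) :
    C.cobarD (x * y) = C.cobarD x * y + sgn (wordGr C.desuspGr) x * C.cobarD y :=
  oddDer_mul _ _ x y

open LinearMap in
theorem cobarD_cobarDLetter (c : C.carrier) : C.cobarD (C.cobarDLetter c) = 0 := by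
  set s := C.sinv with hs
  set e := sgn C.gr with he
  set m := LinearMap.mul' R (TensorAlgebra R C.bar) with hm
  have hD : ∀ z : C.carrier ⊗[R] C.carrier, C.cobarD (m (TensorProduct.map (s ∘ₗ e) s z)) =
      m (TensorProduct.map (C.cobarDLetter ∘ₗ e) s z) -
      m (TensorProduct.map s C.cobarDLetter z) := by
    intro z
    induction z using TensorProduct.induction_on with
    | zero => simp
    | tmul x y =>
      have h1 := LinearMap.congr_fun C.sgn_sinv (e x)
      have h2 := LinearMap.congr_fun (sgn_sgn C.gr) x
      simp only [LinearMap.comp_apply, LinearMap.neg_apply, ← he, ← hs, LinearMap.id_apply] at h1 h2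
      rw [h2] at h1
      have h3 : C.cobarD (s (e x)) = C.cobarDLetter (e x) := C.cobarD_sinv _
      have h4 : C.cobarD (s y) = C.cobarDLetter y := C.cobarD_sinv _
      simp only [TensorProduct.map_tmul, LinearMap.comp_apply, hm, LinearMap.mul'_apply,
        cobarD_mul, h1, h3, h4, neg_mul, sub_eq_add_neg]
    | add x y hx hy => simp only [map_add, hx, hy]; abel
  have hsd : ∀ z, m (TensorProduct.map (s ∘ₗ e) s (tensorD C.gr C.d C.d z)) =
      - m (TensorProduct.map (s ∘ₗ C.d ∘ₗ e) s z) + m (TensorProduct.map s (s ∘ₗ C.d) z) := by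
    intro z
    induction z using TensorProduct.induction_on with
    | zero => simp
    | tmul x y =>
      have h1 := LinearMap.congr_fun (sgn_d C.gr C.d C.d_mem) x
      have h2 := LinearMap.congr_fun (sgn_sgn C.gr) x
      simp only [LinearMap.comp_apply, LinearMap.neg_apply, ← he, LinearMap.id_apply] at h1 h2
      simp [tensorD, hm, ← he, h1, h2]
    | add x y hx hy => simp only [map_add, hx, hy]; abel
  have e1 : C.cobarDLetter ∘ₗ e = - s ∘ₗ C.d ∘ₗ e + m ∘ₗ TensorProduct.map s (s ∘ₗ e) ∘ₗ
      Coalgebra.comul := by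
    ext x
    have h := LinearMap.congr_fun C.comul_sgn x
    simp only [LinearMap.comp_apply, ← he] at h
    have h3 : TensorProduct.map (s ∘ₗ e) s (TensorProduct.map e e (Coalgebra.comul x)) =
        TensorProduct.map s (s ∘ₗ e) (Coalgebra.comul x) := by
      rw [← LinearMap.comp_apply, ← TensorProduct.map_comp, LinearMap.comp_assoc, sgn_sgn,
        LinearMap.comp_id]
    simp [cobarDLetter, ← he, ← hs, ← hm, h, h3]
  have e2 : C.cobarDLetter = - s ∘ₗ C.d + m ∘ₗ TensorProduct.map (s ∘ₗ e) s ∘ₗ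
      Coalgebra.comul := rfl
  have key : ∀ z : (C.carrier ⊗[R] C.carrier) ⊗[R] C.carrier,
      m (TensorProduct.map (m ∘ₗ TensorProduct.map s (s ∘ₗ e)) s z) =
      m (TensorProduct.map s (m ∘ₗ TensorProduct.map (s ∘ₗ e) s)
        (TensorProduct.assoc R _ _ _ z)) := by
    intro z
    induction z using TensorProduct.induction_on with
    | zero => simp
    | tmul x y =>
      induction x using TensorProduct.induction_on with
      | zero => simp
      | tmul x w => simp [hm, mul_assoc]
      | add x w hx hw => simp only [TensorProduct.add_tmul, map_add, hx, hw]
    | add x y hx hy => simp only [map_add, hx, hy]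
  have k2 := key (LinearMap.rTensor _ Coalgebra.comul (Coalgebra.comul c))
  have a1 : ∀ (f : C.carrier ⊗[R] C.carrier →ₗ[R] TensorAlgebra R C.bar)
      (g : C.carrier →ₗ[R] TensorAlgebra R C.bar) (z : C.carrier ⊗[R] C.carrier),
      TensorProduct.map f g (LinearMap.rTensor C.carrier Coalgebra.comul z) =
        TensorProduct.map (f ∘ₗ Coalgebra.comul) g z := by
    intro f g z
    rw [LinearMap.rTensor, ← LinearMap.comp_apply, ← TensorProduct.map_comp, LinearMap.comp_id]
  have a2 : ∀ (g : C.carrier ⊗[R] C.carrier →ₗ[R] TensorAlgebra R C.bar)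
      (f : C.carrier →ₗ[R] TensorAlgebra R C.bar) (z : C.carrier ⊗[R] C.carrier),
      TensorProduct.map f g (LinearMap.lTensor C.carrier Coalgebra.comul z) =
        TensorProduct.map f (g ∘ₗ Coalgebra.comul) z := by
    intro g f z
    rw [LinearMap.lTensor, ← LinearMap.comp_apply, ← TensorProduct.map_comp, LinearMap.comp_id]
  rw [Coalgebra.coassoc_apply, a1, a2] at k2
  have e3 : C.cobarD (C.cobarDLetter c) = - C.cobarD (s (C.d c)) +
      C.cobarD (m (TensorProduct.map (s ∘ₗ e) s (Coalgebra.comul c))) := by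
    conv_lhs => rw [e2]
    simp
  rw [e3, hD, hs, cobarD_sinv, ← hs, e1]
  conv_lhs => rw [e2]
  have b1 : ∀ (f g : C.carrier →ₗ[R] TensorAlgebra R C.bar) (z : C.carrier ⊗[R] C.carrier),
      TensorProduct.map (-f) g z = - TensorProduct.map f g z := by
    intro f g z
    rw [← neg_one_smul R f, TensorProduct.map_smul_left]; simp
  have b2 : ∀ (f g : C.carrier →ₗ[R] TensorAlgebra R C.bar) (z : C.carrier ⊗[R] C.carrier),
      TensorProduct.map f (-g) z = - TensorProduct.map f g z := by
    intro f g z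
    rw [← neg_one_smul R g, TensorProduct.map_smul_right]; simp
  simp only [TensorProduct.map_add_left, TensorProduct.map_add_right, LinearMap.add_apply, map_add,
    LinearMap.neg_apply, LinearMap.comp_apply, C.d_d, C.comul_d, hsd, b1, b2, map_neg, map_zero]
  simp only [LinearMap.comp_assoc] at k2
  rw [k2]
  abel


theorem cobarD_cobarD (x : TensorAlgebra R C.bar) : C.cobarD (C.cobarD x) = 0 := by
  induction x using TensorAlgebra.induction with
  | algebraMap r => simp [Algebra.algebraMap_eq_smul_one, cobarD, oddDer_one]
  | ι x =>
    have : TensorAlgebra.ι R x = C.sinv x := by simp [sinv, toBar_coe]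
    rw [this, cobarD_sinv, cobarD_cobarDLetter]
  | mul a b ha hb =>
    have h := LinearMap.congr_fun (sgn_d (wordGr C.desuspGr) C.cobarD C.cobarD_mem) a
    simp only [LinearMap.comp_apply, LinearMap.neg_apply] at h
    simp [cobarD_mul, ha, hb, h]
  | add a b ha hb => simp [ha, hb]

/-- The cobar construction `Ω C = (T (s⁻¹ C̄), d_Ω)`, augmented by killing all words of positive
length. -/
abbrev cobar : ChainAlg.{u, max u v} R where
  carrier := TensorAlgebra R C.bar
  gr := wordGr C.desuspGr
  d := C.cobarD
  d_mem := C.cobarD_mem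
  d_d := C.cobarD_cobarD
  d_mul := C.cobarD_mul
  aug := TensorAlgebra.algebraMapInv
  aug_of_pos := C.aug_of_pos
  aug_d := C.aug_cobarD

end ChainCoalg

section Main

variable {R : Type u} [CommRing R]

/-- A comultiplication turning an augmented chain algebra into a chain Hopf algebra: a morphism of
chain algebras to the tensor square (with its Koszul-signed multiplication), coassociative, with the
augmentation as counit. -/
structure HopfStr (A : ChainAlg.{u, v} R) where
  comul : A.carrier →ₗ[R] A.carrier ⊗[R] A.carrier
  comul_one : comul 1 = 1 ⊗ₜ[R] 1
  comul_mul : ∀ x y, GradedTensorProduct.of R A.gr A.gr (comul (x * y)) =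
    GradedTensorProduct.of R A.gr A.gr (comul x) * GradedTensorProduct.of R A.gr A.gr (comul y)
  comul_mem : ∀ n, ∀ x ∈ A.gr n, comul x ∈ tensorGr A.gr A.gr n
  comul_d : ∀ x, comul (A.d x) = tensorD A.gr A.d A.d (comul x)
  coassoc : ∀ x, TensorProduct.assoc R A.carrier A.carrier A.carrier
    (TensorProduct.map comul LinearMap.id (comul x)) =
      TensorProduct.map LinearMap.id comul (comul x)
  aug_comul : ∀ x, TensorProduct.map A.aug.toLinearMap LinearMap.id (comul x) = 1 ⊗ₜ[R] x
  comul_aug : ∀ x, TensorProduct.map LinearMap.id A.aug.toLinearMap (comul x) = x ⊗ₜ[R] 1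

/-- The `r`-th power map `Id * ⋯ * Id` of a chain Hopf algebra (`r`-fold convolution product), i.e.
the composite of the iterated comultiplication and the iterated multiplication. -/
def HopfStr.power {A : ChainAlg.{u, v} R} (δ : HopfStr A) : ℕ → (A.carrier →ₗ[R] A.carrier)
  | 0 => Algebra.linearMap R A.carrier ∘ₗ A.aug.toLinearMap
  | r + 1 => LinearMap.mul' R A.carrier ∘ₗ
      TensorProduct.map (HopfStr.power δ r) LinearMap.id ∘ₗ δ.comul

/-- A twisting cochain `t : C → A`: a linear map of degree `-1` with
`d t + t d = μ (t ⊗ t) Δ`. Here `(t ⊗ t)(x ⊗ y) = (-1)^{|x|} t x ⊗ t y` by the Koszul rule. -/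
structure TwistingCochain (C : ChainCoalg.{u, v} R) (A : ChainAlg.{u, w} R) where
  toLin : C.carrier →ₗ[R] A.carrier
  mem : ∀ n, ∀ c ∈ C.gr n, toLin c ∈ predGr A.gr n
  twist : ∀ c, A.d (toLin c) + toLin (C.d c) = LinearMap.mul' R A.carrier
    (TensorProduct.map (toLin ∘ₗ sgn C.gr) toLin (Coalgebra.comul c))

namespace TwistingCochain

variable {C : ChainCoalg.{u, v} R} {A : ChainAlg.{u, w} R} (t : TwistingCochain C A)

/-- The algebra map `α_t : Ω C → A` with `α_t (s⁻¹ c) = t c`. -/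
def alpha : C.cobar.carrier →ₐ[R] A.carrier :=
  TensorAlgebra.lift R (t.toLin ∘ₗ C.bar.subtype)

/-- `y ⊗ x ↦ ∑ (-1)^{|y₁|} y₁ ⊗ t(y₂) x`, where `Δ y = ∑ y₁ ⊗ y₂`. -/
def hochLeft : C.carrier ⊗[R] A.carrier →ₗ[R] C.carrier ⊗[R] A.carrier :=
  TensorProduct.map (sgn C.gr)
      (LinearMap.mul' R A.carrier ∘ₗ TensorProduct.map t.toLin LinearMap.id) ∘ₗ
    (TensorProduct.assoc R C.carrier C.carrier A.carrier).toLinearMap ∘ₗ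
    TensorProduct.map Coalgebra.comul LinearMap.id

/-- `y ⊗ x ↦ ∑ (-1)^{(|y₁| - 1)(|y₂| + |x|)} y₂ ⊗ x t(y₁)`, where `Δ y = ∑ y₁ ⊗ y₂`: the factor
`t(y₁)` is moved past `y₂` and then past `x`. -/
def hochRight : C.carrier ⊗[R] A.carrier →ₗ[R] C.carrier ⊗[R] A.carrier :=
  TensorProduct.map LinearMap.id (LinearMap.mul' R A.carrier ∘ₗ koszul A.gr A.gr) ∘ₗ
    (TensorProduct.assoc R C.carrier A.carrier A.carrier).toLinearMap ∘ₗ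
    TensorProduct.map (koszul A.gr C.gr ∘ₗ TensorProduct.map t.toLin LinearMap.id) LinearMap.id ∘ₗ
    TensorProduct.map Coalgebra.comul LinearMap.id

/-- The differential `d_t` of the Hochschild complex `ℋ(t) = (C ⊗ A, d_t)`. -/
def hochD : C.carrier ⊗[R] A.carrier →ₗ[R] C.carrier ⊗[R] A.carrier :=
  tensorD C.gr C.d A.d - t.hochLeft + t.hochRight

/-- Endomorphisms of the chain complex `ℋ(t)`: linear maps of degree `0` commuting with `d_t`. -/
structure IsChainEnd (φ : C.carrier ⊗[R] A.carrier →ₗ[R] C.carrier ⊗[R] A.carrier) : Prop where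
  mem : ∀ n, ∀ z ∈ tensorGr C.gr A.gr n, φ z ∈ tensorGr C.gr A.gr n
  comm : ∀ z, φ (t.hochD z) = t.hochD (φ z)

end TwistingCochain

/-- Morphisms of coaugmented chain coalgebras. -/
structure ChainCoalg.Hom (C : ChainCoalg.{u, v} R) (C' : ChainCoalg.{u, v} R) where
  toCoalgHom : C.carrier →ₗc[R] C'.carrier
  mem : ∀ n, ∀ c ∈ C.gr n, toCoalgHom c ∈ C'.gr n
  comm : ∀ c, toCoalgHom (C.d c) = C'.d (toCoalgHom c)
  map_one : toCoalgHom C.one = C'.one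

/-- The algebra map `Ω f : Ω C → Ω C'` with `Ω f (s⁻¹ c) = s⁻¹ (f c)`. -/
def ChainCoalg.Hom.cobarMap {C C' : ChainCoalg.{u, v} R} (f : C.Hom C') :
    C.cobar.carrier →ₐ[R] C'.cobar.carrier :=
  TensorAlgebra.lift R (C'.sinv ∘ₗ f.toCoalgHom.toLinearMap ∘ₗ C.bar.subtype)

/-- Morphisms of augmented chain algebras. -/
structure ChainAlg.Hom (A : ChainAlg.{u, v} R) (A' : ChainAlg.{u, v} R) where
  toAlgHom : A.carrier →ₐ[R] A'.carrier
  mem : ∀ n, ∀ a ∈ A.gr n, toAlgHom a ∈ A'.gr n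
  comm : ∀ a, toAlgHom (A.d a) = A'.d (toAlgHom a)
  aug : ∀ a, A'.aug (toAlgHom a) = A.aug a

variable (R) in
/-- Objects of `Twist_HH`: a Hirsch coalgebra `(C, ψ)`, a chain Hopf algebra `(H, δ)` and a
twisting cochain `t : C → H`, where the underlying graded modules of `C` and `H` are free. -/
structure TwistHH where
  C : ChainCoalg.{u, v} R
  ψ : HopfStr C.cobar
  H : ChainAlg.{u, w} R
  δ : HopfStr H
  t : TwistingCochain C H
  free_C : ∀ n, Module.Free R (C.gr n)
  free_H : ∀ n, Module.Free R (H.gr n)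

namespace TwistHH

/-- Morphisms of `Twist_HH`. -/
structure Hom (X Y : TwistHH.{u, v, w} R) where
  f : X.C.Hom Y.C
  g : X.H.Hom Y.H
  twist : ∀ c, g.toAlgHom (X.t.toLin c) = Y.t.toLin (f.toCoalgHom c)
  loop : ∀ x, TensorProduct.map f.cobarMap.toLinearMap f.cobarMap.toLinearMap (X.ψ.comul x) =
    Y.ψ.comul (f.cobarMap x)
  hopf : ∀ x, TensorProduct.map g.toAlgHom.toLinearMap g.toAlgHom.toLinearMap (X.δ.comul x) =
    Y.δ.comul (g.toAlgHom x)

variable (X : TwistHH.{u, v, w} R)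

/-- The algebra map `α_t` is a map of coalgebras `(Ω C, ψ) → (H, δ)`. -/
structure AlphaIsCoalgMap : Prop where
  comul : ∀ x, TensorProduct.map X.t.alpha.toLinearMap X.t.alpha.toLinearMap (X.ψ.comul x) =
    X.δ.comul (X.t.alpha x)
  counit : ∀ x, X.H.aug (X.t.alpha x) = X.C.cobar.aug x

/-- The condition `τ δ t = δ t`, where `τ` is the (Koszul-signed) symmetry of `H ⊗ H`. -/
def IsSymm : Prop :=
  ∀ c, koszul X.H.gr X.H.gr (X.δ.comul (X.t.toLin c)) = X.δ.comul (X.t.toLin c)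

/-- `(Ω C, ψ)` is primitively generated: the generators `s⁻¹ c` of `Ω C` are primitive. -/
def PrimitivelyGenerated : Prop :=
  ∀ c, X.ψ.comul (X.C.sinv c) = X.C.sinv c ⊗ₜ[R] 1 + 1 ⊗ₜ[R] X.C.sinv c

/-- The projection `Id ⊗ ε : ℋ(t) → C`. -/
def proj : X.C.carrier ⊗[R] X.H.carrier →ₗ[R] X.C.carrier :=
  (TensorProduct.rid R X.C.carrier).toLinearMap ∘ₗ
    TensorProduct.map LinearMap.id X.H.aug.toLinearMap

end TwistHH

end Main

end PowerMap

end

/-!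
The Hochschild complex `C ⊗ A` of a twisting cochain `t : C → A` is a model for the cyclic one-forms
on the free algebra `Ω C` with coefficients in `A`, together with the zero-forms `1 ⊗ A`. The element
`c ⊗ b` stands for `d(s⁻¹ c) · b`; a general word `u` gives a one-form `du · b` by the Leibniz rule
`d(u v) · b = du · v b ± dv · b u` (`cyclicForm`, `cyclicForm_mul`), and the Hochschild differential
maps `du · b` to `- d(∂u) · b ∓ du · ∂b - 1 ⊗ [u, b]` (`hochD_cyclicForm`).

For iterated coproducts `u₁ ⊗ ⋯ ⊗ u_r` of `u = s⁻¹ c` and `w₁ ⊗ ⋯ ⊗ w_r` of `w`, the lifted power map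
is, with `α_t` understood,
`c ⊗ w ↦ ∑ ± du₁ · (w₁ u₂ w₂ ⋯ u_r w_r)`, together with `1 ⊗ w ↦ 1 ⊗ λ_r(w)` (`liftedPower`).
It is a chain map because the commutator `[u₁, w₁ u₂ w₂ ⋯ u_r w_r]` sums to
`u₁ w₁ ⋯ u_r w_r - w₁ u₂ w₂ ⋯ u_r w_r u₁`, and the symmetry of `δ(t c)` turns the second term into
`w₁ u₁ ⋯ w_r u_r`, so that the sum is `λ_r([u, w])` (`hochD_formPower`). The same symmetry is needed to
see that the formula stays valid when `s⁻¹ c` is replaced by a product of two letters, as happens in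
`∂(s⁻¹ c)` (`liftedPower_cyclicForm_mul`).

The product `w₁ h₂ w₂ ⋯ h_r w_r` is encoded as `∑ ± w₁ λ_{r-1}(h w₂)` (`interleave`). It is also equal
to `∑ ± λ_{r-1}(w₁ h) w₂` (`interleave_eq_mulPowerLeft`), and its compatibility with products
`y w` and `w x` can be read off from one form each. Below, `r + 1` is the exponent of the lifted
power map, so that `interleave r` is the factor that occurs in it.
-/

noncomputable section

namespace PowerMap

/-! ### Parities and Koszul signs -/

section Parity

variable {R : Type u} [CommRing R]
variable {V : Type v} [AddCommGroup V] [Module R V]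
variable {W : Type w} [AddCommGroup W] [Module R W]

theorem neg_one_pow_congr_mod {m n : ℕ} (h : m % 2 = n % 2) : (-1 : R) ^ m = (-1) ^ n := by
  rw [neg_one_pow_eq_pow_mod_two, h, ← neg_one_pow_eq_pow_mod_two]

/-- The elements of parity `p` of a graded module, i.e. the span of the homogeneous elements whose
degree is congruent to `p` modulo `2`. Since Koszul signs only see parities, working with `par`
allows the differential to be treated as a map of degree `+1`, without truncation at degree `0`. -/
def par (gr : ℕ → Submodule R V) (p : ℕ) : Submodule R V :=
  Submodule.span R {x | ∃ n, n % 2 = p % 2 ∧ x ∈ gr n}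

theorem mem_par {gr : ℕ → Submodule R V} {n : ℕ} {x : V} (hx : x ∈ gr n) : x ∈ par gr n :=
  Submodule.subset_span ⟨n, rfl, hx⟩

theorem par_congr {gr : ℕ → Submodule R V} {p q : ℕ} (h : p % 2 = q % 2) {x : V}
    (hx : x ∈ par gr p) : x ∈ par gr q := by
  unfold par at *
  rwa [← h]

theorem mem_par_of_predGr {gr : ℕ → Submodule R V} {n : ℕ} {x : V} (hx : x ∈ predGr gr n) :
    x ∈ par gr (n + 1) := by
  rcases n with _ | n
  · have : x = 0 := by simpa [predGr] using hx
    rw [this]; exact Submodule.zero_mem _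
  · exact par_congr (by omega) (mem_par (n := n) hx)

/-- Two linear maps that agree on the homogeneous elements of parity `p` agree on `par gr p`. -/
theorem eq_of_mem_par {gr : ℕ → Submodule R V} {p : ℕ} {f g : V →ₗ[R] W}
    (h : ∀ n, n % 2 = p % 2 → ∀ x ∈ gr n, f x = g x) {x : V} (hx : x ∈ par gr p) :
    f x = g x := by
  have : par gr p ≤ LinearMap.eqLocus f g := Submodule.span_le.2 (by
    rintro x ⟨n, hn, hx⟩
    exact h n hn x hx)
  exact this hx

theorem map_mem_par {gr : ℕ → Submodule R V} {gr' : ℕ → Submodule R W} {p q : ℕ} {f : V →ₗ[R] W}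
    (h : ∀ n, n % 2 = p % 2 → ∀ x ∈ gr n, f x ∈ par gr' q) {x : V} (hx : x ∈ par gr p) :
    f x ∈ par gr' q := by
  have : par gr p ≤ (par gr' q).comap f := Submodule.span_le.2 (by
    rintro x ⟨n, hn, hx⟩
    exact h n hn x hx)
  exact this hx

theorem sgn_of_par (gr : ℕ → Submodule R V) [Decomposition gr] {p : ℕ} {x : V}
    (hx : x ∈ par gr p) : sgn gr x = (-1 : R) ^ p • x :=
  eq_of_mem_par (f := sgn gr) (g := ((-1 : R) ^ p) • LinearMap.id)
    (fun n hn x hx => by simp [sgn_of_mem gr hx, neg_one_pow_congr_mod hn]) hx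

theorem koszul_of_par (gr : ℕ → Submodule R V) [Decomposition gr] (gr' : ℕ → Submodule R W)
    [Decomposition gr'] {p q : ℕ} {x : V} {y : W} (hx : x ∈ par gr p) (hy : y ∈ par gr' q) :
    koszul gr gr' (x ⊗ₜ y) = (-1 : R) ^ (p * q) • (y ⊗ₜ x) := by
  refine eq_of_mem_par (f := koszul gr gr' ∘ₗ (TensorProduct.mk R V W).flip y)
    (g := ((-1 : R) ^ (p * q)) • (TensorProduct.mk R W V) y) (fun m hm x hx => ?_) hx
  refine eq_of_mem_par (f := koszul gr gr' ∘ₗ (TensorProduct.mk R V W) x)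
    (g := ((-1 : R) ^ (p * q)) • (TensorProduct.mk R W V).flip x) (fun n hn y hy => ?_) hy
  simp [koszul_of_mem gr gr' hx hy,
    neg_one_pow_congr_mod (show (m * n) % 2 = (p * q) % 2 by rw [Nat.mul_mod, hm, hn, ← Nat.mul_mod])]

theorem d_mem_par {gr : ℕ → Submodule R V} {d : V →ₗ[R] V} (hd : ∀ n, ∀ x ∈ gr n, d x ∈ predGr gr n)
    {p : ℕ} {x : V} (hx : x ∈ par gr p) : d x ∈ par gr (p + 1) :=
  map_mem_par (fun n hn x hx => par_congr (by omega) (mem_par_of_predGr (hd n x hx))) hx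

/-- An element of degree `n` of a tensor product is a finite sum of tensors of homogeneous
elements of total degree `n`. -/
theorem exists_sum_of_mem_tensorGr {gr : ℕ → Submodule R V} {gr' : ℕ → Submodule R W} {n : ℕ}
    {z : V ⊗[R] W} (hz : z ∈ tensorGr gr gr' n) :
    ∃ (k : ℕ) (a b : Fin k → ℕ) (x : Fin k → V) (y : Fin k → W), (∀ i, a i + b i = n) ∧
      (∀ i, x i ∈ gr (a i)) ∧ (∀ i, y i ∈ gr' (b i)) ∧ z = ∑ i, x i ⊗ₜ[R] y i := by
  obtain ⟨k, f, g, rfl⟩ := (Submodule.mem_span_set' (R := R)).1 hz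
  choose a b hab x hx y hy h using fun i => (g i).2
  refine ⟨k, a, b, fun i => f i • x i, y, hab, fun i => Submodule.smul_mem _ _ (hx i), hy, ?_⟩
  simp only [← h, TensorProduct.smul_tmul']

theorem tmul_mem_tensorGr {gr : ℕ → Submodule R V} {gr' : ℕ → Submodule R W} {m n k : ℕ}
    {x : V} {y : W} (hx : x ∈ gr m) (hy : y ∈ gr' n) (h : m + n = k) :
    x ⊗ₜ[R] y ∈ tensorGr gr gr' k :=
  Submodule.subset_span ⟨m, n, h, x, hx, y, hy, rfl⟩

/-- To prove that two linear maps agree, it is enough to check homogeneous elements. -/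
theorem linearMap_ext_gr (gr : ℕ → Submodule R V) [Decomposition gr] {f g : V →ₗ[R] W}
    (h : ∀ n, ∀ x ∈ gr n, f x = g x) : f = g := by
  apply decompose_lhom_ext gr
  intro n
  ext x
  exact h n x x.2

theorem tensor_ext_gr {U : Type*} [AddCommGroup U] [Module R U] (gr : ℕ → Submodule R V)
    [Decomposition gr] (gr' : ℕ → Submodule R W)
    [Decomposition gr'] {f g : V ⊗[R] W →ₗ[R] U}
    (h : ∀ m n, ∀ x ∈ gr m, ∀ y ∈ gr' n, f (x ⊗ₜ y) = g (x ⊗ₜ y)) : f = g := by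
  apply TensorProduct.ext
  refine linearMap_ext_gr gr fun m x hx => linearMap_ext_gr gr' fun n y hy => ?_
  exact h m n x hx y hy

section Algebra

variable {A : Type v} [Ring A] [Algebra R A] (gr : ℕ → Submodule R A) [GradedAlgebra gr]

theorem mul_mem_par {p q : ℕ} {x y : A} (hx : x ∈ par gr p) (hy : y ∈ par gr q) :
    x * y ∈ par gr (p + q) := by
  refine map_mem_par (f := LinearMap.mulRight R y) (fun m hm x hx => ?_) hx
  refine map_mem_par (f := LinearMap.mulLeft R x) (fun n hn y hy => ?_) hy
  exact par_congr (by omega) (mem_par (SetLike.mul_mem_graded hx hy))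

theorem one_mem_par : (1 : A) ∈ par gr 0 := mem_par (SetLike.GradedOne.one_mem (A := gr))

theorem sgn_mul (x y : A) : sgn gr (x * y) = sgn gr x * sgn gr y := by
  have : sgn gr ∘ₗ LinearMap.mul' R A =
      LinearMap.mul' R A ∘ₗ TensorProduct.map (sgn gr) (sgn gr) := by
    apply tensor_ext_gr gr gr
    intro m n x hx y hy
    have := SetLike.mul_mem_graded hx hy
    simp [sgn_of_mem gr hx, sgn_of_mem gr hy, sgn_of_mem gr this, smul_smul, pow_add, mul_comm]
  simpa using LinearMap.congr_fun this (x ⊗ₜ y)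

open GradedTensorProduct in
theorem gradedTmul_mul {p q : ℕ} (a₁ : A) {b₁ a₂ : A} (b₂ : A) (h₁ : b₁ ∈ par gr p)
    (h₂ : a₂ ∈ par gr q) :
    (of R gr gr (a₁ ⊗ₜ b₁) * of R gr gr (a₂ ⊗ₜ b₂)) =
      (-1 : R) ^ (p * q) • of R gr gr ((a₁ * a₂) ⊗ₜ (b₁ * b₂)) := by
  refine eq_of_mem_par (f := LinearMap.mulRight R (of R gr gr (a₂ ⊗ₜ b₂)) ∘ₗ
      (of R gr gr).toLinearMap ∘ₗ TensorProduct.mk R A A a₁)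
    (g := (-1 : R) ^ (p * q) • ((of R gr gr).toLinearMap ∘ₗ
      TensorProduct.mk R A A (a₁ * a₂) ∘ₗ LinearMap.mulRight R b₂)) (fun m hm b₁ h₁ => ?_) h₁
  refine eq_of_mem_par (f := LinearMap.mulLeft R (of R gr gr (a₁ ⊗ₜ b₁)) ∘ₗ
      (of R gr gr).toLinearMap ∘ₗ (TensorProduct.mk R A A).flip b₂)
    (g := (-1 : R) ^ (p * q) • ((of R gr gr).toLinearMap ∘ₗ
      (TensorProduct.mk R A A).flip (b₁ * b₂) ∘ₗ LinearMap.mulLeft R a₁)) (fun n hn a₂ h₂ => ?_) h₂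
  have := tmul_coe_mul_coe_tmul (R := R) gr gr a₁ ⟨b₁, h₁⟩ ⟨a₂, h₂⟩ b₂
  simp only [Units.smul_def, ← Int.cast_smul_eq_zsmul R] at this
  simp only [LinearMap.comp_apply, LinearMap.mulLeft_apply, LinearEquiv.coe_coe,
    TensorProduct.mk_apply, LinearMap.flip_apply, LinearMap.smul_apply]
  refine this.trans ?_
  rw [← neg_one_pow_congr_mod (R := R)
    (show (m * n) % 2 = (p * q) % 2 by rw [Nat.mul_mod, hm, hn, ← Nat.mul_mod])]
  simp

end Algebra

end Parity

/-! ### Power maps and interleaved products in a chain Hopf algebra -/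

theorem ChainAlg.d_mul_of_par {R : Type u} [CommRing R] (A : ChainAlg.{u, v} R) {p : ℕ}
    {x : A.carrier} (hx : x ∈ par A.gr p) (y : A.carrier) :
    A.d (x * y) = A.d x * y + (-1 : R) ^ p • (x * A.d y) := by
  rw [A.d_mul, sgn_of_par A.gr hx, smul_mul_assoc]

theorem ChainAlg.d_one {R : Type u} [CommRing R] (A : ChainAlg.{u, v} R) : A.d 1 = 0 := by
  have := A.d_mem 0 1 (SetLike.GradedOne.one_mem (A := A.gr))
  simpa [predGr] using this

theorem tensorD_tmul_of_par {R : Type u} [CommRing R] {V : Type v} [AddCommGroup V] [Module R V]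
    {W : Type w} [AddCommGroup W] [Module R W] (gr : ℕ → Submodule R V) [Decomposition gr]
    (d : V →ₗ[R] V) (d' : W →ₗ[R] W) {p : ℕ} {x : V} (hx : x ∈ par gr p) (y : W) :
    tensorD gr d d' (x ⊗ₜ y) = d x ⊗ₜ y + (-1 : R) ^ p • (x ⊗ₜ d' y) := by
  simp [tensorD, sgn_of_par gr hx, TensorProduct.smul_tmul']

namespace HopfStr

open GradedTensorProduct

variable {R : Type u} [CommRing R] {A : ChainAlg.{u, v} R} (δ : HopfStr A)

theorem power_zero_apply (x : A.carrier) : δ.power 0 x = algebraMap R _ (A.aug x) := rfl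

theorem power_succ_apply (r : ℕ) (x : A.carrier) : δ.power (r + 1) x =
    LinearMap.mul' R A.carrier (TensorProduct.map (δ.power r) LinearMap.id (δ.comul x)) := rfl

theorem power_mem (r n : ℕ) (x : A.carrier) (hx : x ∈ A.gr n) : δ.power r x ∈ A.gr n := by
  induction r generalizing n x with
  | zero =>
    rw [power_zero_apply]
    rcases n with _ | n
    · rw [Algebra.algebraMap_eq_smul_one]
      exact Submodule.smul_mem _ _ (SetLike.GradedOne.one_mem (A := A.gr))
    · rw [A.aug_of_pos _ n.succ_pos _ hx, map_zero]
      exact Submodule.zero_mem _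
  | succ r ih =>
    obtain ⟨k, a, b, x', y', hab, hx', hy', h⟩ := exists_sum_of_mem_tensorGr (δ.comul_mem n x hx)
    rw [power_succ_apply, h]
    simp only [map_sum, TensorProduct.map_tmul, LinearMap.mul'_apply, LinearMap.id_apply]
    refine Submodule.sum_mem _ fun i _ => ?_
    rw [← hab i]
    exact SetLike.mul_mem_graded (ih _ _ (hx' i)) (hy' i)

theorem power_mem_par (r : ℕ) {p : ℕ} {x : A.carrier} (hx : x ∈ par A.gr p) :
    δ.power r x ∈ par A.gr p :=
  map_mem_par (fun n hn x hx => par_congr hn (mem_par (δ.power_mem r n x hx))) hx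

theorem d_power (r : ℕ) (x : A.carrier) : A.d (δ.power r x) = δ.power r (A.d x) := by
  induction r generalizing x with
  | zero =>
    simp [power_zero_apply, A.aug_d, Algebra.algebraMap_eq_smul_one, A.d_one]
  | succ r ih =>
    rw [power_succ_apply, power_succ_apply, δ.comul_d]
    refine LinearMap.congr_fun (f := A.d ∘ₗ LinearMap.mul' R A.carrier ∘ₗ
      TensorProduct.map (δ.power r) LinearMap.id) (g := LinearMap.mul' R A.carrier ∘ₗ
      TensorProduct.map (δ.power r) LinearMap.id ∘ₗ tensorD A.gr A.d A.d) ?_ _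
    apply tensor_ext_gr A.gr A.gr
    intro m n x hx y hy
    have hx' := mem_par hx
    simp [tensorD_tmul_of_par A.gr A.d A.d hx', A.d_mul_of_par (δ.power_mem_par r hx'), ih]

theorem aug_power (r : ℕ) (x : A.carrier) : A.aug (δ.power r x) = A.aug x := by
  induction r generalizing x with
  | zero => simp [power_zero_apply]
  | succ r ih =>
    have h := congrArg (fun z => A.aug (TensorProduct.lid R A.carrier z)) (δ.aug_comul x)
    simp only [TensorProduct.lid_tmul, one_smul] at h
    rw [← h, power_succ_apply]
    refine LinearMap.congr_fun (f := A.aug.toLinearMap ∘ₗ LinearMap.mul' R A.carrier ∘ₗ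
      TensorProduct.map (δ.power r) LinearMap.id) (g := A.aug.toLinearMap ∘ₗ
      (TensorProduct.lid R A.carrier).toLinearMap ∘ₗ
      TensorProduct.map A.aug.toLinearMap LinearMap.id) ?_ _
    ext x y
    simp [ih]

theorem map_power {A' : ChainAlg.{u, v} R} (δ' : HopfStr A') (g : A.Hom A')
    (hg : ∀ x, TensorProduct.map g.toAlgHom.toLinearMap g.toAlgHom.toLinearMap (δ.comul x) =
      δ'.comul (g.toAlgHom x)) (r : ℕ) (x : A.carrier) :
    g.toAlgHom (δ.power r x) = δ'.power r (g.toAlgHom x) := by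
  induction r generalizing x with
  | zero => simp [power_zero_apply, g.aug]
  | succ r ih =>
    rw [power_succ_apply, power_succ_apply, ← hg]
    refine LinearMap.congr_fun (f := g.toAlgHom.toLinearMap ∘ₗ LinearMap.mul' R A.carrier ∘ₗ
      TensorProduct.map (δ.power r) LinearMap.id) (g := LinearMap.mul' R A'.carrier ∘ₗ
      TensorProduct.map (δ'.power r) LinearMap.id ∘ₗ
      TensorProduct.map g.toAlgHom.toLinearMap g.toAlgHom.toLinearMap) ?_ _
    ext x y
    simp [ih]

/-- The comultiplication, with values in the tensor square with its Koszul-signed product. -/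
def comulG : A.carrier →ₗ[R] GradedTensorProduct R A.gr A.gr :=
  (of R A.gr A.gr).toLinearMap ∘ₗ δ.comul

theorem comulG_mul (x y : A.carrier) : δ.comulG (x * y) = δ.comulG x * δ.comulG y :=
  δ.comul_mul x y

/-- `x ⊗ y ↦ λ_r(x) y` on the Koszul-signed tensor square. -/
def mulPowerLeft (r : ℕ) : GradedTensorProduct R A.gr A.gr →ₗ[R] A.carrier :=
  LinearMap.mul' R A.carrier ∘ₗ TensorProduct.map (δ.power r) LinearMap.id ∘ₗ
    (of R A.gr A.gr).symm.toLinearMap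

/-- `x ⊗ y ↦ x λ_r(y)` on the Koszul-signed tensor square. -/
def mulPowerRight (r : ℕ) : GradedTensorProduct R A.gr A.gr →ₗ[R] A.carrier :=
  LinearMap.mul' R A.carrier ∘ₗ TensorProduct.map LinearMap.id (δ.power r) ∘ₗ
    (of R A.gr A.gr).symm.toLinearMap

@[simp]
theorem mulPowerLeft_of (r : ℕ) (x y : A.carrier) :
    δ.mulPowerLeft r (of R A.gr A.gr (x ⊗ₜ y)) = δ.power r x * y := by
  simp [mulPowerLeft]

@[simp]
theorem mulPowerRight_of (r : ℕ) (x y : A.carrier) :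
    δ.mulPowerRight r (of R A.gr A.gr (x ⊗ₜ y)) = x * δ.power r y := by
  simp [mulPowerRight]

theorem mulPowerLeft_comulG (r : ℕ) (x : A.carrier) :
    δ.mulPowerLeft r (δ.comulG x) = δ.power (r + 1) x := rfl

theorem gradedTensor_ext {W : Type*} [AddCommGroup W] [Module R W]
    {f g : GradedTensorProduct R A.gr A.gr →ₗ[R] W}
    (h : ∀ m n, ∀ x ∈ A.gr m, ∀ y ∈ A.gr n,
      f (of R A.gr A.gr (x ⊗ₜ y)) = g (of R A.gr A.gr (x ⊗ₜ y))) : f = g :=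
  GradedTensorProduct.hom_ext _ _ (tensor_ext_gr A.gr A.gr h)

theorem mulPowerLeft_mul (r : ℕ) (z : GradedTensorProduct R A.gr A.gr) (k : A.carrier) :
    δ.mulPowerLeft r (z * of R A.gr A.gr (1 ⊗ₜ k)) = δ.mulPowerLeft r z * k := by
  refine LinearMap.congr_fun (f := δ.mulPowerLeft r ∘ₗ
    LinearMap.mulRight R (of R A.gr A.gr (1 ⊗ₜ k)))
    (g := LinearMap.mulRight R k ∘ₗ δ.mulPowerLeft r) ?_ z
  apply gradedTensor_ext
  intro m n x hx y hy
  simp [gradedTmul_mul A.gr _ _ (mem_par hy) (one_mem_par A.gr), mul_assoc]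

theorem mulPowerRight_mul (r : ℕ) (z : GradedTensorProduct R A.gr A.gr) (k : A.carrier) :
    δ.mulPowerRight r (of R A.gr A.gr (k ⊗ₜ 1) * z) = k * δ.mulPowerRight r z := by
  refine LinearMap.congr_fun (f := δ.mulPowerRight r ∘ₗ
    LinearMap.mulLeft R (of R A.gr A.gr (k ⊗ₜ 1)))
    (g := LinearMap.mulLeft R k ∘ₗ δ.mulPowerRight r) ?_ z
  apply gradedTensor_ext
  intro m n x hx y hy
  simp [gradedTmul_mul A.gr _ _ (one_mem_par A.gr) (mem_par hx), mul_assoc]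

/-- The interleaved product `∑ ± w₁ h₁ w₂ h₂ ⋯ h_r w_{r+1}` of the `r`-fold iterated coproduct of
`h` with the `(r+1)`-fold iterated coproduct of `w`. It is encoded as `∑ ± w₁ λ_r(h w₂)`, the image
of `(1 ⊗ h) δ(w)` under `x ⊗ y ↦ x λ_r(y)`. -/
def interleave (r : ℕ) : A.carrier →ₗ[R] A.carrier →ₗ[R] A.carrier :=
  LinearMap.mk₂ R
    (fun h w => δ.mulPowerRight r (of R A.gr A.gr (1 ⊗ₜ h) * δ.comulG w))
    (fun h h' w => by simp [TensorProduct.tmul_add, add_mul])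
    (fun c h w => by simp)
    (fun h w w' => by simp [mul_add])
    (fun c h w => by simp)

theorem interleave_apply (r : ℕ) (h w : A.carrier) : δ.interleave r h w =
    δ.mulPowerRight r (of R A.gr A.gr (1 ⊗ₜ h) * δ.comulG w) := rfl

theorem mulPowerRight_one_tmul_mul (r : ℕ) {p a : ℕ} {h x : A.carrier} (hh : h ∈ par A.gr p)
    (hx : x ∈ par A.gr a) (y : A.carrier) :
    δ.mulPowerRight r (of R A.gr A.gr (1 ⊗ₜ h) * of R A.gr A.gr (x ⊗ₜ y)) =
      (-1 : R) ^ (p * a) • (x * δ.power r (h * y)) := by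
  rw [gradedTmul_mul A.gr _ _ hh hx]
  simp

theorem interleave_eq_sum (r : ℕ) {p k : ℕ} {h w : A.carrier} (hh : h ∈ par A.gr p)
    {a : Fin k → ℕ} {x y : Fin k → A.carrier} (hx : ∀ i, x i ∈ A.gr (a i))
    (hw : δ.comul w = ∑ i, x i ⊗ₜ y i) :
    δ.interleave r h w = ∑ i, (-1 : R) ^ (p * a i) • (x i * δ.power r (h * y i)) := by
  simp [interleave_apply, comulG, hw, Finset.mul_sum,
    δ.mulPowerRight_one_tmul_mul r hh (mem_par (hx _))]

theorem interleave_mem (r : ℕ) {p q : ℕ} {h w : A.carrier} (hh : h ∈ A.gr p) (hw : w ∈ A.gr q) :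
    δ.interleave r h w ∈ A.gr (p + q) := by
  obtain ⟨k, a, b, x, y, hab, hx, hy, e⟩ := exists_sum_of_mem_tensorGr (δ.comul_mem q w hw)
  rw [δ.interleave_eq_sum r (mem_par hh) hx e]
  refine Submodule.sum_mem _ fun i _ => Submodule.smul_mem _ _ ?_
  rw [show p + q = a i + (p + b i) by rw [← hab i]; ring]
  exact SetLike.mul_mem_graded (hx i) (δ.power_mem r _ _ (SetLike.mul_mem_graded hh (hy i)))

theorem aug_interleave (r : ℕ) (h w : A.carrier) :
    A.aug (δ.interleave r h w) = A.aug h * A.aug w := by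
  have e := congrArg (fun z => A.aug (TensorProduct.lid R A.carrier z)) (δ.aug_comul w)
  simp only [TensorProduct.lid_tmul, one_smul] at e
  have key : A.aug.toLinearMap ∘ₗ δ.mulPowerRight r ∘ₗ
      LinearMap.mulLeft R (of R A.gr A.gr (1 ⊗ₜ h)) ∘ₗ (of R A.gr A.gr).toLinearMap =
    A.aug h • (A.aug.toLinearMap ∘ₗ (TensorProduct.lid R A.carrier).toLinearMap ∘ₗ
      TensorProduct.map A.aug.toLinearMap LinearMap.id) := by
    apply tensor_ext_gr A.gr A.gr
    intro m n x hx y hy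
    refine LinearMap.congr_fun (f := A.aug.toLinearMap ∘ₗ δ.mulPowerRight r ∘ₗ
        LinearMap.mulRight R (of R A.gr A.gr (x ⊗ₜ y)) ∘ₗ (of R A.gr A.gr).toLinearMap ∘ₗ
        TensorProduct.mk R _ _ 1)
      (g := (A.aug x * A.aug y) • A.aug.toLinearMap) ?_ h |>.trans ?_
    · apply linearMap_ext_gr A.gr
      intro p h hh
      simp only [LinearMap.comp_apply, LinearMap.mulRight_apply, LinearEquiv.coe_coe,
        TensorProduct.mk_apply, δ.mulPowerRight_one_tmul_mul r (mem_par hh) (mem_par hx)]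
      rcases m with _ | m
      · simp [aug_power]; ring
      · simp [A.aug_of_pos _ m.succ_pos _ hx]
    · simp; ring
  have := LinearMap.congr_fun key (δ.comul w)
  simp only [LinearMap.comp_apply, LinearMap.smul_apply] at this
  refine this.trans ?_
  rw [smul_eq_mul]
  congr 1

theorem d_interleave (r : ℕ) {p : ℕ} {h : A.carrier} (hh : h ∈ par A.gr p) (w : A.carrier) :
    A.d (δ.interleave r h w) =
      δ.interleave r (A.d h) w + (-1 : R) ^ p • δ.interleave r h (A.d w) := by
  have key : A.d ∘ₗ δ.mulPowerRight r ∘ₗ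
      LinearMap.mulLeft R (of R A.gr A.gr (1 ⊗ₜ h)) ∘ₗ (of R A.gr A.gr).toLinearMap =
    δ.mulPowerRight r ∘ₗ
      LinearMap.mulLeft R (of R A.gr A.gr (1 ⊗ₜ A.d h)) ∘ₗ (of R A.gr A.gr).toLinearMap +
    (-1 : R) ^ p • (δ.mulPowerRight r ∘ₗ LinearMap.mulLeft R (of R A.gr A.gr (1 ⊗ₜ h)) ∘ₗ
      (of R A.gr A.gr).toLinearMap ∘ₗ tensorD A.gr A.d A.d) := by
    apply tensor_ext_gr A.gr A.gr
    intro m n x hx y hy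
    have hx := mem_par hx
    have hdx := d_mem_par A.d_mem hx
    have hdh := d_mem_par A.d_mem hh
    simp only [LinearMap.comp_apply, LinearMap.add_apply, LinearMap.smul_apply,
      LinearMap.mulLeft_apply, LinearEquiv.coe_coe, tensorD_tmul_of_par A.gr A.d A.d hx, map_add,
      map_smul, mul_add, mul_smul_comm, δ.mulPowerRight_one_tmul_mul r hh hx,
      δ.mulPowerRight_one_tmul_mul r hdh hx, δ.mulPowerRight_one_tmul_mul r hh hdx,
      A.d_mul_of_par hx, A.d_mul_of_par hh, d_power, smul_add, smul_smul]
    rcases neg_one_pow_eq_or R p with hp | hp <;> rcases neg_one_pow_eq_or R m with hm | hm <;>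
    simp only [add_mul, pow_add, pow_mul, hp, hm, one_pow, one_mul, mul_one, mul_neg, neg_neg,
      neg_smul, one_smul] <;> abel
  have := LinearMap.congr_fun key (δ.comul w)
  simp only [LinearMap.comp_apply, LinearMap.smul_apply, LinearMap.add_apply, ← δ.comul_d] at this
  exact this

theorem map_interleave {A' : ChainAlg.{u, v} R} (δ' : HopfStr A') (g : A.Hom A')
    (hg : ∀ x, TensorProduct.map g.toAlgHom.toLinearMap g.toAlgHom.toLinearMap (δ.comul x) =
      δ'.comul (g.toAlgHom x)) (r : ℕ) (h w : A.carrier) :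
    g.toAlgHom (δ.interleave r h w) = δ'.interleave r (g.toAlgHom h) (g.toAlgHom w) := by
  refine LinearMap.congr_fun (f := g.toAlgHom.toLinearMap ∘ₗ (δ.interleave r).flip w)
    (g := (δ'.interleave r).flip (g.toAlgHom w) ∘ₗ g.toAlgHom.toLinearMap) ?_ h
  apply linearMap_ext_gr A.gr
  intro p h hh
  have hgh := mem_par (g.mem p h hh)
  have hh := mem_par hh
  refine LinearMap.congr_fun (f := g.toAlgHom.toLinearMap ∘ₗ (δ.interleave r) h)
    (g := (δ'.interleave r) (g.toAlgHom h) ∘ₗ g.toAlgHom.toLinearMap) ?_ w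
  apply linearMap_ext_gr A.gr
  intro q w hw
  obtain ⟨k, a, b, x, y, hab, hx, hy, e⟩ := exists_sum_of_mem_tensorGr (δ.comul_mem q w hw)
  have e' := hg w
  rw [e] at e'
  simp only [map_sum, TensorProduct.map_tmul, AlgHom.toLinearMap_apply] at e'
  simp only [LinearMap.comp_apply, AlgHom.toLinearMap_apply]
  rw [δ.interleave_eq_sum r hh hx e,
    δ'.interleave_eq_sum r hgh (fun i => g.mem _ _ (hx i)) e'.symm]
  simp [δ.map_power δ' g hg]

end HopfStr

/-! ### Two groupings of the interleaved product -/

theorem sgn_pow_of_mem {R : Type u} [CommRing R] {V : Type v} [AddCommGroup V] [Module R V]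
    (gr : ℕ → Submodule R V) [Decomposition gr] (p : ℕ) {n : ℕ} {x : V} (hx : x ∈ gr n) :
    (sgn gr ^ p : Module.End R V) x = (-1 : R) ^ (p * n) • x := by
  induction p with
  | zero => simp
  | succ p ih =>
    rw [pow_succ, Module.End.mul_apply, sgn_of_mem gr hx, map_smul, ih, smul_smul, ← pow_add]
    congr 2
    ring

theorem map_sgn_pow_of_mem {R : Type u} [CommRing R] {V : Type v} [AddCommGroup V] [Module R V]
    (gr : ℕ → Submodule R V) [Decomposition gr] (p : ℕ) {n : ℕ} {z : V ⊗[R] V}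
    (hz : z ∈ tensorGr gr gr n) :
    TensorProduct.map (sgn gr ^ p : Module.End R V) (sgn gr ^ p : Module.End R V) z =
      (-1 : R) ^ (p * n) • z := by
  obtain ⟨k, a, b, x, y, hab, hx, hy, rfl⟩ := exists_sum_of_mem_tensorGr hz
  rw [map_sum, Finset.smul_sum]
  refine Finset.sum_congr rfl fun i _ => ?_
  rw [TensorProduct.map_tmul, sgn_pow_of_mem gr p (hx i), sgn_pow_of_mem gr p (hy i),
    TensorProduct.smul_tmul_smul, ← pow_add, ← mul_add, hab]

namespace HopfStr

open GradedTensorProduct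

variable {R : Type u} [CommRing R] {A : ChainAlg.{u, v} R} (δ : HopfStr A)

theorem mulPowerLeft_mul_tmul_one (r : ℕ) {p b : ℕ} {h y : A.carrier} (hh : h ∈ par A.gr p)
    (hy : y ∈ par A.gr b) (x : A.carrier) :
    δ.mulPowerLeft r (of R A.gr A.gr (x ⊗ₜ y) * of R A.gr A.gr (h ⊗ₜ 1)) =
      (-1 : R) ^ (b * p) • (δ.power r (x * h) * y) := by
  rw [gradedTmul_mul A.gr _ _ hy hh]
  simp

theorem of_eq_mul (u v : A.carrier) : of R A.gr A.gr (u ⊗ₜ v) =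
    of R A.gr A.gr (u ⊗ₜ 1) * of R A.gr A.gr (1 ⊗ₜ v) := by
  rw [gradedTmul_mul A.gr _ _ (one_mem_par A.gr) (one_mem_par A.gr)]
  simp

/-- Coassociativity step for the comparison of the two forms of the interleaved product. -/
theorem sum_interleave_mul (r : ℕ) {c e k : ℕ} {u v w : A.carrier} (hu : u ∈ A.gr c)
    (hv : v ∈ A.gr e) {a : Fin k → ℕ} {x y : Fin k → A.carrier}
    (hx : ∀ i, x i ∈ A.gr (a i)) (hw : δ.comul w = ∑ i, x i ⊗ₜ y i) :
    ∑ j, (-1 : R) ^ (e * a j) • (δ.interleave r u (x j) * (v * y j)) =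
      ∑ j, (-1 : R) ^ ((c + e) * a j) •
        (x j * δ.mulPowerLeft r (of R A.gr A.gr (u ⊗ₜ v) * δ.comulG (y j))) := by
  have key : (LinearMap.mul' R A.carrier ∘ₗ
      TensorProduct.map (sgn A.gr ^ (c + e) : Module.End R A.carrier)
        (δ.mulPowerLeft r ∘ₗ LinearMap.mulLeft R (of R A.gr A.gr (u ⊗ₜ v)) ∘ₗ
          (of R A.gr A.gr).toLinearMap)) ∘ₗ (TensorProduct.assoc R _ _ _).toLinearMap =
      LinearMap.mul' R A.carrier ∘ₗ
      TensorProduct.map (δ.mulPowerRight r ∘ₗ LinearMap.mulLeft R (of R A.gr A.gr (1 ⊗ₜ u)) ∘ₗ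
          (of R A.gr A.gr).toLinearMap ∘ₗ
          TensorProduct.map (sgn A.gr ^ e : Module.End R A.carrier)
            (sgn A.gr ^ e : Module.End R A.carrier)) (LinearMap.mulLeft R v) := by
    apply TensorProduct.ext
    apply tensor_ext_gr A.gr A.gr
    intro m n x hx y hy
    ext z
    have hx' := mem_par hx
    have hy' := mem_par hy
    simp only [LinearMap.compr₂ₛₗ_apply, TensorProduct.mk_apply, LinearMap.comp_apply,
      LinearEquiv.coe_coe, TensorProduct.assoc_tmul, TensorProduct.map_tmul,
      LinearMap.mulLeft_apply, LinearMap.mul'_apply, sgn_pow_of_mem A.gr _ hx,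
      sgn_pow_of_mem A.gr _ hy, gradedTmul_mul A.gr _ _ (mem_par hv) hy', map_smul,
      TensorProduct.smul_tmul_smul, δ.mulPowerRight_one_tmul_mul r (mem_par hu) hx',
      smul_mul_assoc, smul_smul, mulPowerLeft_of, mul_assoc]
    congr 1
    simp only [← pow_add]
    apply neg_one_pow_congr_mod
    congr 1
    ring
  have h := LinearMap.congr_fun key (TensorProduct.map δ.comul LinearMap.id (δ.comul w))
  rw [LinearMap.comp_apply, LinearEquiv.coe_coe, δ.coassoc, hw] at h
  simp only [LinearMap.comp_apply, map_sum, TensorProduct.map_tmul, LinearMap.id_apply,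
    LinearMap.mul'_apply, LinearMap.mulLeft_apply, LinearEquiv.coe_coe,
    sgn_pow_of_mem A.gr _ (hx _), map_sgn_pow_of_mem A.gr _ (δ.comul_mem _ _ (hx _)), map_smul,
    smul_mul_assoc] at h
  exact h.symm

/-- The interleaved product can be grouped from the left or from the right:
`∑ ± w₁ λ_r(h w₂) = ∑ ± λ_r(w₁ h) w₂`. -/
theorem interleave_eq_mulPowerLeft (r : ℕ) {p q : ℕ} {h w : A.carrier} (hh : h ∈ A.gr p)
    (hw : w ∈ A.gr q) : δ.interleave r h w =
      (-1 : R) ^ (p * q) • δ.mulPowerLeft r (δ.comulG w * of R A.gr A.gr (h ⊗ₜ 1)) := by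
  induction r generalizing p q h w with
  | zero =>
    obtain ⟨k, a, b, x, y, hab, hx, hy, e⟩ := exists_sum_of_mem_tensorGr (δ.comul_mem q w hw)
    have e1 := congrArg (TensorProduct.lid R A.carrier) (δ.aug_comul w)
    have e2 := congrArg (TensorProduct.rid R A.carrier) (δ.comul_aug w)
    rw [δ.interleave_eq_sum 0 (mem_par hh) hx e]
    simp only [comulG, LinearMap.comp_apply, e, map_sum, Finset.sum_mul, LinearEquiv.coe_coe,
      δ.mulPowerLeft_mul_tmul_one 0 (mem_par hh) (mem_par (hy _)), power_zero_apply, map_mul]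
    have hc : ∀ (c : R) (z : A.carrier), z * algebraMap R A.carrier c = c • z := fun c z => by
      rw [← Algebra.commutes, Algebra.smul_def]
    -- An element `h` of positive degree is killed by the augmentation, so both sides vanish; in
    -- degree `0` there are no signs and the counit laws apply.
    rcases p with _ | p
    · simp only [e, map_sum, TensorProduct.map_tmul, LinearMap.id_apply, TensorProduct.lid_tmul,
        TensorProduct.rid_tmul, one_smul, AlgHom.toLinearMap_apply] at e1 e2
      simp only [zero_mul, mul_zero, pow_zero, one_smul, hc, ← Algebra.smul_def, mul_smul_comm,
        smul_mul_assoc]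
      simp only [smul_comm _ (A.aug h), ← Finset.smul_sum, e1, e2]
    · simp [A.aug_of_pos _ p.succ_pos _ hh]
  | succ r ih =>
    obtain ⟨k, a, b, x, y, hab, hx, hy, e⟩ := exists_sum_of_mem_tensorGr (δ.comul_mem q w hw)
    obtain ⟨l, c, d, u, v, hcd, hu, hv, e'⟩ := exists_sum_of_mem_tensorGr (δ.comul_mem p h hh)
    have e'' : δ.comulG h = ∑ i, of R A.gr A.gr (u i ⊗ₜ v i) := by simp [comulG, e']
    have h1 : δ.interleave (r + 1) h w = ∑ i, ∑ j, (-1 : R) ^ ((c i + d i) * a j) •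
        (x j * δ.mulPowerLeft r (of R A.gr A.gr (u i ⊗ₜ v i) * δ.comulG (y j))) := by
      rw [δ.interleave_eq_sum (r + 1) (mem_par hh) hx e, Finset.sum_comm]
      refine Finset.sum_congr rfl fun j _ => ?_
      simp only [← mulPowerLeft_comulG, comulG_mul, e'', Finset.sum_mul, map_sum, Finset.mul_sum,
        Finset.smul_sum, hcd]
    have h2 : ∀ j, δ.power (r + 1) (x j * h) =
        ∑ i, (-1 : R) ^ (c i * a j) • (δ.interleave r (u i) (x j) * v i) := by
      intro j
      simp only [← mulPowerLeft_comulG, comulG_mul, e'', Finset.mul_sum, map_sum]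
      refine Finset.sum_congr rfl fun i _ => ?_
      rw [ih (hu i) (hx j), of_eq_mul, ← mul_assoc, mulPowerLeft_mul, smul_mul_assoc, smul_smul,
        ← pow_add, ← two_mul, pow_mul, neg_one_sq, one_pow, one_smul]
    rw [h1]
    simp only [← δ.sum_interleave_mul r (hu _) (hv _) hx e]
    simp only [comulG, LinearMap.comp_apply, e, map_sum, Finset.sum_mul, LinearEquiv.coe_coe,
      δ.mulPowerLeft_mul_tmul_one (r + 1) (mem_par hh) (mem_par (hy _)), h2, Finset.smul_sum]
    rw [Finset.sum_comm]
    refine Finset.sum_congr rfl fun j _ => Finset.sum_congr rfl fun i _ => ?_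
    rw [smul_mul_assoc, smul_smul, smul_smul, ← mul_assoc (δ.interleave r (u i) (x j)), ← pow_add,
      ← pow_add]
    congr 1
    rw [← hcd i, ← hab j]
    apply neg_one_pow_congr_mod
    have : (c i + d i) * (a j + b j) + (b j * (c i + d i) + c i * a j) =
      d i * a j + 2 * (c i * a j + (c i + d i) * b j) := by ring
    omega

theorem interleave_one_left (r : ℕ) (w : A.carrier) :
    δ.interleave r 1 w = δ.power (r + 1) w := by
  refine LinearMap.congr_fun (f := δ.interleave r 1) ?_ w
  apply linearMap_ext_gr A.gr
  intro q w hw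
  rw [δ.interleave_eq_mulPowerLeft r (SetLike.GradedOne.one_mem (A := A.gr)) hw]
  have : of R A.gr A.gr (1 ⊗ₜ[R] (1 : A.carrier)) = 1 := rfl
  simp [this, mulPowerLeft_comulG]

/-- Moving a left factor `y` of the second argument: both sides spell out
`y₁ w₁ h₁ y₂ w₂ ⋯`. This uses the form `∑ ± w₁ λ_r(h w₂)`. -/
theorem interleave_mul_left (r : ℕ) {p k : ℕ} {h y : A.carrier} (w : A.carrier)
    (hh : h ∈ A.gr p) {a : Fin k → ℕ} {y₁ y₂ : Fin k → A.carrier}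
    (hy₁ : ∀ i, y₁ i ∈ A.gr (a i)) (e : δ.comul y = ∑ i, y₁ i ⊗ₜ y₂ i) :
    δ.interleave r h (y * w) =
      ∑ i, (-1 : R) ^ (p * a i) • (y₁ i * δ.interleave r (h * y₂ i) w) := by
  have e' : δ.comulG y = ∑ i, of R A.gr A.gr (y₁ i ⊗ₜ y₂ i) := by simp [comulG, e]
  rw [interleave_apply, comulG_mul, e', ← mul_assoc, Finset.mul_sum, Finset.sum_mul, map_sum]
  refine Finset.sum_congr rfl fun i _ => ?_
  rw [gradedTmul_mul A.gr _ _ (mem_par hh) (mem_par (hy₁ i)), smul_mul_assoc, map_smul, one_mul,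
    of_eq_mul, mul_assoc, mulPowerRight_mul, interleave_apply]

/-- Moving a right factor `x` of the second argument: both sides spell out
`w₁ x₁ h₁ w₂ x₂ ⋯`. This uses the form `∑ ± λ_r(w₁ h) w₂`. -/
theorem interleave_mul_right (r : ℕ) {p q n k : ℕ} {h w x : A.carrier}
    (hh : h ∈ A.gr p) (hw : w ∈ A.gr q) (hx : x ∈ A.gr n) {a b : Fin k → ℕ}
    {x₁ x₂ : Fin k → A.carrier} (hab : ∀ i, a i + b i = n)
    (hx₁ : ∀ i, x₁ i ∈ A.gr (a i)) (hx₂ : ∀ i, x₂ i ∈ A.gr (b i))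
    (e : δ.comul x = ∑ i, x₁ i ⊗ₜ x₂ i) :
    δ.interleave r h (w * x) =
      ∑ i, (-1 : R) ^ (a i * (p + q)) • (δ.interleave r (x₁ i * h) w * x₂ i) := by
  have e' : δ.comulG x = ∑ i, of R A.gr A.gr (x₁ i ⊗ₜ x₂ i) := by simp [comulG, e]
  rw [δ.interleave_eq_mulPowerLeft r hh (SetLike.mul_mem_graded hw hx), comulG_mul, e', mul_assoc,
    Finset.sum_mul, Finset.mul_sum, map_sum, Finset.smul_sum]
  refine Finset.sum_congr rfl fun i _ => ?_
  rw [δ.interleave_eq_mulPowerLeft r (SetLike.mul_mem_graded (hx₁ i) hh) hw,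
    gradedTmul_mul A.gr _ _ (mem_par (hx₂ i)) (mem_par hh), mul_one,
    of_eq_mul, mul_smul_comm, ← mul_assoc, map_smul, mulPowerLeft_mul, smul_mul_assoc, smul_smul,
    smul_smul, ← pow_add, ← pow_add]
  congr 1
  apply neg_one_pow_congr_mod
  rw [← hab i]
  have : p * (q + (a i + b i)) + b i * p + 0 + (a i * (p + q) + (a i + p) * q) =
    2 * (p * q + a i * p + b i * p + a i * q) := by ring
  omega

end HopfStr

/-! ### Words in the cobar construction -/

theorem ChainCoalg.one_mem {R : Type u} [CommRing R] (C : ChainCoalg.{u, v} R) :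
    C.one ∈ C.gr 0 := by
  rw [C.connected]; exact Submodule.mem_span_singleton_self _

theorem ChainCoalg.ι_eq_sinv {R : Type u} [CommRing R] (C : ChainCoalg.{u, v} R) (c : C.bar) :
    TensorAlgebra.ι R c = C.sinv c := by
  simp [sinv, toBar_coe]

/-- Induction on the homogeneous elements of the cobar construction, one letter at a time. -/
theorem ChainCoalg.word_induction {R : Type u} [CommRing R] (C : ChainCoalg.{u, v} R)
    {P : ℕ → TensorAlgebra R C.bar → Prop} (one : P 0 1)
    (mul : ∀ m n c u, c ∈ C.gr (m + 1) → u ∈ wordGr C.desuspGr n → P n u →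
      P (m + n) (C.sinv c * u))
    (zero : ∀ n, P n 0) (add : ∀ n u v, P n u → P n v → P n (u + v))
    (smul : ∀ n (r : R) u, P n u → P n (r • u))
    {n : ℕ} {u : TensorAlgebra R C.bar} (hu : u ∈ wordGr C.desuspGr n) : P n u := by
  induction hu using Submodule.span_induction with
  | mem x h =>
    obtain ⟨l, hl, rfl⟩ := h
    subst hl
    induction l with
    | nil => simpa using one
    | cons a l ih =>
      simp only [List.map_cons, List.prod_cons, List.sum_cons, C.ι_eq_sinv]
      refine mul _ _ _ _ a.2.2 ?_ (by simpa only [C.ι_eq_sinv] using ih)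
      exact Submodule.subset_span ⟨l, rfl, by simp [C.ι_eq_sinv]⟩
  | zero => exact zero _
  | add x y _ _ hx hy => exact add _ _ _ hx hy
  | smul r x _ hx => exact smul _ _ _ hx

namespace TwistingCochain

variable {R : Type u} [CommRing R] {C : ChainCoalg.{u, v} R} {A : ChainAlg.{u, w} R}
  (t : TwistingCochain C A)

/-! ### The algebra map of a twisting cochain -/

theorem toLin_one : t.toLin C.one = 0 := by
  simpa [predGr] using t.mem 0 _ C.one_mem

/-- The algebra map `α_t`, with its source written as a tensor algebra. -/
def wordMap : TensorAlgebra R C.bar →ₐ[R] A.carrier :=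
  TensorAlgebra.lift R (t.toLin ∘ₗ C.bar.subtype)

theorem wordMap_sinv (c : C.carrier) : t.wordMap (C.sinv c) = t.toLin c := by
  simp [wordMap, ChainCoalg.sinv, C.coe_toBar, t.toLin_one]

theorem wordMap_mem {n : ℕ} {u : TensorAlgebra R C.bar} (hu : u ∈ wordGr C.desuspGr n) :
    t.wordMap u ∈ A.gr n := by
  refine C.word_induction (P := fun n u => t.wordMap u ∈ A.gr n) ?_ ?_ ?_ ?_ ?_ hu
  · rw [map_one]; exact SetLike.GradedOne.one_mem (A := A.gr)
  · intro m n c u hc _ ih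
    rw [map_mul, wordMap_sinv]
    exact SetLike.mul_mem_graded (t.mem _ c hc) ih
  · intro n; rw [map_zero]; exact Submodule.zero_mem _
  · intro n u v hu hv; rw [map_add]; exact Submodule.add_mem _ hu hv
  · intro n r u hu; rw [map_smul]; exact Submodule.smul_mem _ _ hu

theorem wordMap_sgn (u : TensorAlgebra R C.bar) :
    t.wordMap (sgn (wordGr C.desuspGr) u) = sgn A.gr (t.wordMap u) := by
  refine LinearMap.congr_fun (f := t.wordMap.toLinearMap ∘ₗ sgn (wordGr C.desuspGr))
    (g := sgn A.gr ∘ₗ t.wordMap.toLinearMap) ?_ u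
  apply linearMap_ext_gr (wordGr C.desuspGr)
  intro n x hx
  simp [sgn_of_mem _ hx, sgn_of_mem _ (t.wordMap_mem hx)]

theorem wordMap_cobarDLetter (c : C.carrier) : t.wordMap (C.cobarDLetter c) = A.d (t.toLin c) := by
  have h := t.twist c
  have key : t.wordMap.toLinearMap ∘ₗ LinearMap.mul' R (TensorAlgebra R C.bar) ∘ₗ
    TensorProduct.map (C.sinv ∘ₗ sgn C.gr) C.sinv =
    LinearMap.mul' R A.carrier ∘ₗ TensorProduct.map (t.toLin ∘ₗ sgn C.gr) t.toLin := by
    ext x y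
    simp [wordMap_sinv]
  have key := LinearMap.congr_fun key (Coalgebra.comul c)
  simp only [LinearMap.comp_apply, AlgHom.toLinearMap_apply] at key
  simp only [ChainCoalg.cobarDLetter, LinearMap.add_apply, LinearMap.neg_apply,
    LinearMap.comp_apply, map_add, map_neg, wordMap_sinv, key, ← h]
  abel

theorem wordMap_cobarD (u : TensorAlgebra R C.bar) :
    t.wordMap (C.cobarD u) = A.d (t.wordMap u) := by
  induction u using TensorAlgebra.induction with
  | algebraMap r =>
    simp [Algebra.algebraMap_eq_smul_one, ChainCoalg.cobarD, oddDer_one, A.d_one]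
  | ι x => rw [C.ι_eq_sinv, C.cobarD_sinv, wordMap_cobarDLetter, wordMap_sinv]
  | mul a b ha hb =>
    rw [C.cobarD_mul, map_add, map_mul, map_mul, ha, hb, wordMap_sgn, map_mul, A.d_mul]
  | add a b ha hb => rw [map_add, map_add, ha, hb, map_add, map_add]

/-! ### Cyclic one-forms on the cobar construction -/

/-- The action of a letter `s⁻¹ c` on pairs `(x, n)`, where `n` is a one-form in the bimodule
`A ⊗ C ⊗ A`: it sends `(x, n)` to `(t(c) x, 1 ⊗ c ⊗ x + (-1)^{|s⁻¹ c|} t(c) n)`. -/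
def letterAct : C.bar →ₗ[R] Module.End R (A.carrier × A.carrier ⊗[R] (C.carrier ⊗[R] A.carrier)) :=
  LinearMap.mk₂ R
    (fun c p => (t.toLin c * p.1, 1 ⊗ₜ ((c : C.carrier) ⊗ₜ p.1) -
      TensorProduct.map (LinearMap.mul R A.carrier (t.toLin (sgn C.gr c))) LinearMap.id p.2))
    (fun c c' p => by
      simp only [Submodule.coe_add, map_add, add_mul, TensorProduct.add_tmul, TensorProduct.tmul_add,
        TensorProduct.map_add_left, LinearMap.add_apply, Prod.mk_add_mk]
      congr 1
      abel)
    (fun r c p => by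
      simp [TensorProduct.map_smul_left, ← TensorProduct.smul_tmul', smul_sub])
    (fun c p p' => by
      simp only [Prod.fst_add, Prod.snd_add, mul_add, TensorProduct.tmul_add, map_add,
        Prod.mk_add_mk]
      congr 1
      abel)
    (fun r c p => by simp [smul_sub])

/-- The universal one-form `du` in the bimodule `A ⊗ C ⊗ A`, i.e. the derivation of degree `+1`
along `α_t` with `d(s⁻¹ c) = 1 ⊗ c ⊗ 1`. -/
def oneForm : TensorAlgebra R C.bar →ₗ[R] A.carrier ⊗[R] (C.carrier ⊗[R] A.carrier) :=
  LinearMap.snd R _ _ ∘ₗ LinearMap.applyₗ (1, 0) ∘ₗ (TensorAlgebra.lift R t.letterAct).toLinearMap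

/-- Right multiplication on the last factor of `A ⊗ C ⊗ A`. -/
def mulLast : A.carrier →ₗ[R] A.carrier ⊗[R] (C.carrier ⊗[R] A.carrier) →ₗ[R]
    A.carrier ⊗[R] (C.carrier ⊗[R] A.carrier) :=
  LinearMap.lTensorHom (R := R) A.carrier ∘ₗ LinearMap.lTensorHom C.carrier ∘ₗ
    (LinearMap.mul R A.carrier).flip

@[simp]
theorem mulLast_tmul (b x z : A.carrier) (y : C.carrier) :
    mulLast b (x ⊗ₜ[R] (y ⊗ₜ[R] z)) = x ⊗ₜ (y ⊗ₜ (z * b)) := rfl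

theorem mulLast_mulLast (b b' : A.carrier) (n : A.carrier ⊗[R] (C.carrier ⊗[R] A.carrier)) :
    mulLast b (mulLast b' n) = mulLast (b' * b) n := by
  refine LinearMap.congr_fun (f := mulLast b ∘ₗ mulLast b') (g := mulLast (b' * b)) ?_ n
  ext x y z
  simp [mul_assoc]

/-- Left multiplication on the first factor of `A ⊗ C ⊗ A`. -/
def mulFirst : A.carrier →ₗ[R] A.carrier ⊗[R] (C.carrier ⊗[R] A.carrier) →ₗ[R]
    A.carrier ⊗[R] (C.carrier ⊗[R] A.carrier) :=
  LinearMap.rTensorHom (R := R) (C.carrier ⊗[R] A.carrier) ∘ₗ LinearMap.mul R A.carrier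

@[simp]
theorem mulFirst_tmul (b x : A.carrier) (y : C.carrier ⊗[R] A.carrier) :
    mulFirst b (x ⊗ₜ[R] y) = (b * x) ⊗ₜ y := rfl

theorem mulFirst_mulFirst (b b' : A.carrier) (n : A.carrier ⊗[R] (C.carrier ⊗[R] A.carrier)) :
    mulFirst b (mulFirst b' n) = mulFirst (b * b') n := by
  refine LinearMap.congr_fun (f := mulFirst b ∘ₗ mulFirst b') (g := mulFirst (b * b')) ?_ n
  ext x y z
  simp [mul_assoc]

theorem mulFirst_mulLast (b b' : A.carrier) (n : A.carrier ⊗[R] (C.carrier ⊗[R] A.carrier)) :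
    mulFirst b (mulLast b' n) = mulLast b' (mulFirst b n) := by
  refine LinearMap.congr_fun (f := mulFirst b ∘ₗ mulLast b') (g := mulLast b' ∘ₗ mulFirst b) ?_ n
  ext x y z
  simp

theorem letterAct_apply (c : C.bar) (x : A.carrier)
    (n : A.carrier ⊗[R] (C.carrier ⊗[R] A.carrier)) : t.letterAct c (x, n) =
      (t.toLin c * x, 1 ⊗ₜ ((c : C.carrier) ⊗ₜ x) - mulFirst (t.toLin (sgn C.gr c)) n) := rfl

theorem oneForm_apply (u : TensorAlgebra R C.bar) :
    t.oneForm u = (TensorAlgebra.lift R t.letterAct u (1, 0)).2 := rfl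

theorem oneForm_one : t.oneForm 1 = 0 := by simp [oneForm_apply]

theorem oneForm_sinv (c : C.carrier) :
    t.oneForm (C.sinv c) = 1 ⊗ₜ ((C.toBar c : C.carrier) ⊗ₜ 1) := by
  simp [oneForm_apply, ChainCoalg.sinv, letterAct_apply]

theorem toLin_sgn (c : C.carrier) : t.toLin (sgn C.gr c) = - sgn A.gr (t.toLin c) := by
  refine LinearMap.congr_fun (f := t.toLin ∘ₗ sgn C.gr) (g := - (sgn A.gr ∘ₗ t.toLin)) ?_ c
  apply linearMap_ext_gr C.gr
  intro n x hx
  simp [sgn_of_mem _ hx, sgn_of_par _ (mem_par_of_predGr (t.mem n x hx)), pow_succ]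

/-- The action of a word on a pair, as dictated by the Leibniz rule for `oneForm`. -/
theorem lift_letterAct (u : TensorAlgebra R C.bar) (x : A.carrier)
    (n : A.carrier ⊗[R] (C.carrier ⊗[R] A.carrier)) :
    TensorAlgebra.lift R t.letterAct u (x, n) =
      (t.wordMap u * x, mulLast x (t.oneForm u) + mulFirst (sgn A.gr (t.wordMap u)) n) := by
  have h1 : sgn A.gr (1 : A.carrier) = 1 := by
    simp [sgn_of_mem A.gr (SetLike.GradedOne.one_mem (A := A.gr))]
  induction u using TensorAlgebra.induction generalizing x n with
  | algebraMap r =>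
    have h2 : mulFirst (1 : A.carrier) n = n := by
      refine LinearMap.congr_fun (f := mulFirst (1 : A.carrier)) (g := LinearMap.id) ?_ n
      ext x y z
      simp
    simp [Algebra.algebraMap_eq_smul_one, oneForm_one, h1, h2]
  | ι c =>
    rw [TensorAlgebra.lift_ι_apply, letterAct_apply, C.ι_eq_sinv, oneForm_sinv, wordMap_sinv,
      toLin_sgn, C.toBar_coe, map_neg, LinearMap.neg_apply, sub_neg_eq_add, mulLast_tmul, one_mul]
  | mul a b ha hb =>
    have h : t.oneForm (a * b) = mulLast (t.wordMap b) (t.oneForm a) +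
        mulFirst (sgn A.gr (t.wordMap a)) (t.oneForm b) := by
      rw [oneForm_apply, map_mul, Module.End.mul_apply, hb, ha]
      have h3 : mulLast (1 : A.carrier) (t.oneForm b) = t.oneForm b := by
        refine LinearMap.congr_fun (f := mulLast (1 : A.carrier)) (g := LinearMap.id) ?_ _
        ext x y z
        simp
      simp [h3]
    rw [map_mul (TensorAlgebra.lift R t.letterAct), Module.End.mul_apply, hb, ha, h,
      map_mul t.wordMap, sgn_mul]
    simp only [map_add, mulLast_mulLast, mulFirst_mulFirst, mulFirst_mulLast, mul_assoc, add_assoc]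
  | add a b ha hb =>
    simp only [map_add, LinearMap.add_apply, ha, hb, Prod.mk_add_mk, add_mul]
    congr 1
    abel

theorem oneForm_mul (a b : TensorAlgebra R C.bar) :
    t.oneForm (a * b) = mulLast (t.wordMap b) (t.oneForm a) +
      mulFirst (sgn A.gr (t.wordMap a)) (t.oneForm b) := by
  have h : t.oneForm b = (TensorAlgebra.lift R t.letterAct b (1, 0)).2 := rfl
  rw [oneForm_apply, map_mul, Module.End.mul_apply, ← Prod.mk.eta
    (p := TensorAlgebra.lift R t.letterAct b (1, 0)), lift_letterAct, ← h, lift_letterAct]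
  simp

theorem mulFirst_mem {p q : ℕ} {x : A.carrier} (hx : x ∈ A.gr p)
    {n : A.carrier ⊗[R] (C.carrier ⊗[R] A.carrier)}
    (hn : n ∈ tensorGr A.gr (tensorGr C.gr A.gr) q) :
    mulFirst x n ∈ tensorGr A.gr (tensorGr C.gr A.gr) (p + q) := by
  obtain ⟨k, a, b, y, z, hab, hy, hz, rfl⟩ := exists_sum_of_mem_tensorGr hn
  rw [map_sum]
  refine Submodule.sum_mem _ fun i _ => ?_
  rw [mulFirst_tmul]
  exact tmul_mem_tensorGr (SetLike.mul_mem_graded hx (hy i)) (hz i) (by rw [← hab i]; ring)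

theorem mulLast_mem {p q : ℕ} {x : A.carrier} (hx : x ∈ A.gr p)
    {n : A.carrier ⊗[R] (C.carrier ⊗[R] A.carrier)}
    (hn : n ∈ tensorGr A.gr (tensorGr C.gr A.gr) q) :
    mulLast x n ∈ tensorGr A.gr (tensorGr C.gr A.gr) (q + p) := by
  obtain ⟨k, a, b, y, z, hab, hy, hz, rfl⟩ := exists_sum_of_mem_tensorGr hn
  rw [map_sum]
  refine Submodule.sum_mem _ fun i _ => ?_
  obtain ⟨k', a', b', y', z', hab', hy', hz', e⟩ := exists_sum_of_mem_tensorGr (hz i)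
  rw [e, TensorProduct.tmul_sum, map_sum]
  refine Submodule.sum_mem _ fun j _ => ?_
  rw [mulLast_tmul]
  exact tmul_mem_tensorGr (hy i) (tmul_mem_tensorGr (hy' j) (SetLike.mul_mem_graded (hz' j) hx) rfl)
    (by rw [← hab i, ← hab' j]; ring)

theorem oneForm_mem {n : ℕ} {u : TensorAlgebra R C.bar} (hu : u ∈ wordGr C.desuspGr n) :
    t.oneForm u ∈ tensorGr A.gr (tensorGr C.gr A.gr) (n + 1) := by
  refine C.word_induction (P := fun n u =>
    t.oneForm u ∈ tensorGr A.gr (tensorGr C.gr A.gr) (n + 1)) ?_ ?_ ?_ ?_ ?_ hu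
  · rw [oneForm_one]; exact Submodule.zero_mem _
  · intro m n c u hc hu ih
    have hX : t.toLin c ∈ A.gr m := t.mem _ c hc
    have h1 : (1 : A.carrier) ∈ A.gr 0 := SetLike.GradedOne.one_mem (A := A.gr)
    rw [oneForm_mul, wordMap_sinv, sgn_of_par A.gr (par_congr (q := m) (by omega)
      (mem_par_of_predGr (t.mem (m + 1) c hc))), map_smul, LinearMap.smul_apply, oneForm_sinv,
      mulLast_tmul, one_mul]
    refine Submodule.add_mem _ ?_ (Submodule.smul_mem _ _ ?_)
    · exact tmul_mem_tensorGr h1 (tmul_mem_tensorGr (C.toBar_mem hc) (t.wordMap_mem hu) rfl)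
        (by ring)
    · rw [add_assoc]
      exact mulFirst_mem hX ih
  · intro n; rw [map_zero]; exact Submodule.zero_mem _
  · intro n u v hu hv; rw [map_add]; exact Submodule.add_mem _ hu hv
  · intro n r u hu; rw [map_smul]; exact Submodule.smul_mem _ _ hu

/-- The cyclic rotation `x ⊗ y ⊗ z ↦ (-1)^{|x| (|y| + |z|)} y ⊗ z x` from the bimodule `A ⊗ C ⊗ A` to
`C ⊗ A`. -/
def rotate : A.carrier ⊗[R] (C.carrier ⊗[R] A.carrier) →ₗ[R] C.carrier ⊗[R] A.carrier :=
  TensorProduct.map LinearMap.id (LinearMap.mul' R A.carrier ∘ₗ koszul A.gr A.gr) ∘ₗ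
    (TensorProduct.assoc R C.carrier A.carrier A.carrier).toLinearMap ∘ₗ
    TensorProduct.map (koszul A.gr C.gr) LinearMap.id ∘ₗ
    (TensorProduct.assoc R A.carrier C.carrier A.carrier).symm.toLinearMap

theorem rotate_tmul {p q m : ℕ} {x z : A.carrier} {y : C.carrier} (hx : x ∈ par A.gr p)
    (hy : y ∈ par C.gr q) (hz : z ∈ par A.gr m) :
    rotate (x ⊗ₜ[R] (y ⊗ₜ[R] z)) = (-1 : R) ^ (p * (q + m)) • (y ⊗ₜ (z * x)) := by
  simp [rotate, koszul_of_par A.gr C.gr hx hy, koszul_of_par A.gr A.gr hx hz,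
    ← TensorProduct.smul_tmul', smul_smul, mul_add, pow_add]

theorem rotate_mem {q : ℕ} {n : A.carrier ⊗[R] (C.carrier ⊗[R] A.carrier)}
    (hn : n ∈ tensorGr A.gr (tensorGr C.gr A.gr) q) : rotate n ∈ tensorGr C.gr A.gr q := by
  obtain ⟨k, a, b, y, z, hab, hy, hz, rfl⟩ := exists_sum_of_mem_tensorGr hn
  rw [map_sum]
  refine Submodule.sum_mem _ fun i _ => ?_
  obtain ⟨k', a', b', y', z', hab', hy', hz', e⟩ := exists_sum_of_mem_tensorGr (hz i)
  rw [e, TensorProduct.tmul_sum, map_sum]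
  refine Submodule.sum_mem _ fun j _ => ?_
  rw [rotate_tmul (mem_par (hy i)) (mem_par (hy' j)) (mem_par (hz' j))]
  exact Submodule.smul_mem _ _ (tmul_mem_tensorGr (hy' j) (SetLike.mul_mem_graded (hz' j) (hy i))
    (by rw [← hab i, ← hab' j]; ring))

/-- Rotation identifies the left and the right multiplication of the bimodule up to Koszul sign; this
is what makes one-forms cyclic. -/
theorem rotate_mulFirst {p q : ℕ} {x : A.carrier} (hx : x ∈ A.gr p)
    {n : A.carrier ⊗[R] (C.carrier ⊗[R] A.carrier)}
    (hn : n ∈ tensorGr A.gr (tensorGr C.gr A.gr) q) :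
    rotate (mulFirst x n) = (-1 : R) ^ (p * q) • rotate (mulLast x n) := by
  obtain ⟨k, a, b, y, z, hab, hy, hz, rfl⟩ := exists_sum_of_mem_tensorGr hn
  simp only [map_sum, Finset.smul_sum]
  refine Finset.sum_congr rfl fun i _ => ?_
  obtain ⟨k', a', b', y', z', hab', hy', hz', e⟩ := exists_sum_of_mem_tensorGr (hz i)
  rw [e, TensorProduct.tmul_sum]
  simp only [map_sum, Finset.smul_sum]
  refine Finset.sum_congr rfl fun j _ => ?_
  rw [mulFirst_tmul, mulLast_tmul, rotate_tmul (mul_mem_par A.gr (mem_par hx) (mem_par (hy i)))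
    (mem_par (hy' j)) (mem_par (hz' j)), rotate_tmul (mem_par (hy i))
    (mem_par (hy' j)) (mul_mem_par A.gr (mem_par (hz' j)) (mem_par hx)), smul_smul, ← pow_add,
    mul_assoc]
  congr 1
  apply neg_one_pow_congr_mod
  rw [← hab i, ← hab' j]
  have : p * (a i + (a' j + b' j)) + a i * (a' j + (b' j + p)) =
    (p + a i) * (a' j + b' j) + 2 * (a i * p) := by ring
  omega

/-- The cyclic one-form `du · b` in `C ⊗ A`, the image of `(du) b` under the cyclic rotation; on a
word it is given by
`d(s⁻¹c₁ ⋯ s⁻¹cₙ) · b = ∑ᵢ ± cᵢ ⊗ t(cᵢ₊₁) ⋯ t(cₙ) b t(c₁) ⋯ t(cᵢ₋₁)`. -/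
def cyclicForm : TensorAlgebra R C.bar →ₗ[R] A.carrier →ₗ[R] C.carrier ⊗[R] A.carrier :=
  LinearMap.mk₂ R (fun u b => rotate (mulLast b (t.oneForm u)))
    (fun u v b => by simp) (fun r u b => by simp) (fun u b b' => by simp) (fun r u b => by simp)

theorem cyclicForm_apply (u : TensorAlgebra R C.bar) (b : A.carrier) :
    t.cyclicForm u b = rotate (mulLast b (t.oneForm u)) := rfl

theorem cyclicForm_one (b : A.carrier) : t.cyclicForm 1 b = 0 := by
  simp [cyclicForm_apply, oneForm_one]

theorem cyclicForm_sinv (c : C.carrier) (b : A.carrier) :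
    t.cyclicForm (C.sinv c) b = (C.toBar c : C.carrier) ⊗ₜ b := by
  refine LinearMap.congr_fun (f := t.cyclicForm (C.sinv c))
    (g := TensorProduct.mk R _ _ (C.toBar c : C.carrier)) ?_ b
  apply linearMap_ext_gr A.gr
  intro q b hb
  refine LinearMap.congr_fun (f := t.cyclicForm.flip b ∘ₗ C.sinv)
    (g := (TensorProduct.mk R _ _).flip b ∘ₗ C.bar.subtype ∘ₗ C.toBar) ?_ c
  apply linearMap_ext_gr C.gr
  rintro (_ | n) c hc
  · simp [ChainCoalg.sinv, C.toBar_of_mem_zero hc]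
  · have : (C.toBar c : C.carrier) ∈ C.gr (n + 1) := C.toBar_mem hc
    simp [cyclicForm_apply, oneForm_sinv,
      rotate_tmul (one_mem_par A.gr) (mem_par this) (mem_par hb)]

theorem cyclicForm_mem {n q : ℕ} {u : TensorAlgebra R C.bar} {b : A.carrier}
    (hu : u ∈ wordGr C.desuspGr n) (hb : b ∈ A.gr q) :
    t.cyclicForm u b ∈ tensorGr C.gr A.gr (n + 1 + q) :=
  rotate_mem (mulLast_mem hb (t.oneForm_mem hu))

/-- Leibniz rule for cyclic one-forms: `d(u v) · b = du · v b ± dv · b u`. -/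
theorem cyclicForm_mul {p m q : ℕ} {u v : TensorAlgebra R C.bar} {b : A.carrier}
    (hu : u ∈ par (wordGr C.desuspGr) p) (hv : v ∈ par (wordGr C.desuspGr) m)
    (hb : b ∈ par A.gr q) :
    t.cyclicForm (u * v) b = t.cyclicForm u (t.wordMap v * b) +
      (-1 : R) ^ (p * (m + q)) • t.cyclicForm v (b * t.wordMap u) := by
  refine eq_of_mem_par (f := t.cyclicForm.flip b ∘ₗ LinearMap.mulRight R v)
    (g := t.cyclicForm.flip (t.wordMap v * b) + (-1 : R) ^ (p * (m + q)) • (t.cyclicForm v ∘ₗ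
      LinearMap.mulLeft R b ∘ₗ t.wordMap.toLinearMap)) (fun p' hp u hu => ?_) hu
  refine eq_of_mem_par (f := t.cyclicForm.flip b ∘ₗ LinearMap.mulLeft R u)
    (g := t.cyclicForm u ∘ₗ LinearMap.mulRight R b ∘ₗ t.wordMap.toLinearMap +
      (-1 : R) ^ (p * (m + q)) • t.cyclicForm.flip (b * t.wordMap u)) (fun m' hm v hv => ?_) hv
  refine eq_of_mem_par (f := t.cyclicForm (u * v))
    (g := t.cyclicForm u ∘ₗ LinearMap.mulLeft R (t.wordMap v) +
      (-1 : R) ^ (p * (m + q)) • (t.cyclicForm v ∘ₗ LinearMap.mulRight R (t.wordMap u)))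
      (fun q' hq b hb => ?_) hb
  have e : (-1 : R) ^ (p * (m + q)) = (-1 : R) ^ (p' * (m' + q')) := by
    apply neg_one_pow_congr_mod
    rw [Nat.mul_mod, Nat.add_mod, ← hp, ← hm, ← hq, ← Nat.add_mod, ← Nat.mul_mod]
  simp only [LinearMap.add_apply, LinearMap.comp_apply, LinearMap.smul_apply,
    LinearMap.mulLeft_apply, LinearMap.mulRight_apply, e]
  rw [cyclicForm_apply, oneForm_mul, map_add, map_add, mulLast_mulLast,
    sgn_of_mem A.gr (t.wordMap_mem hu), map_smul, LinearMap.smul_apply, map_smul, map_smul,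
    ← mulFirst_mulLast, rotate_mulFirst (t.wordMap_mem hu) (mulLast_mem hb (t.oneForm_mem hv)),
    mulLast_mulLast, smul_smul, ← pow_add, cyclicForm_apply, cyclicForm_apply]
  congr 2
  apply neg_one_pow_congr_mod
  have : p' + p' * (m' + 1 + q') = p' * (m' + q') + 2 * p' := by ring
  omega

end TwistingCochain

/-! ### The Hochschild differential on cyclic one-forms -/

namespace ChainCoalg

variable {R : Type u} [CommRing R] (C : ChainCoalg.{u, v} R)

theorem d_one : C.d C.one = 0 := by
  simpa [predGr] using C.d_mem 0 _ C.one_mem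

theorem sinv_mem_of_mem {n : ℕ} {c : C.carrier} (hc : c ∈ C.gr (n + 1)) :
    C.sinv c ∈ wordGr C.desuspGr n := C.sinv_mem (n + 1) c hc

theorem sinv_mem_par {n : ℕ} {c : C.carrier} (hc : c ∈ C.gr n) :
    C.sinv c ∈ par (wordGr C.desuspGr) (n + 1) := mem_par_of_predGr (C.sinv_mem n c hc)

theorem sum_counit_smul {c : C.carrier} {k : ℕ} {x y : Fin k → C.carrier}
    (e : Coalgebra.comul (R := R) c = ∑ i, x i ⊗ₜ[R] y i) :
    ∑ i, Coalgebra.counit (R := R) (x i) • y i = c := by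
  have := congrArg (TensorProduct.lid R C.carrier) (Coalgebra.rTensor_counit_comul (R := R) c)
  simpa [e] using this

theorem sum_smul_counit {c : C.carrier} {k : ℕ} {x y : Fin k → C.carrier}
    (e : Coalgebra.comul (R := R) c = ∑ i, x i ⊗ₜ[R] y i) :
    ∑ i, Coalgebra.counit (R := R) (y i) • x i = c := by
  have := congrArg (TensorProduct.rid R C.carrier) (Coalgebra.lTensor_counit_comul (R := R) c)
  simpa [e] using this

theorem cobarDLetter_eq_sum {c : C.carrier} {k : ℕ} {a : Fin k → ℕ} {x y : Fin k → C.carrier}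
    (hx : ∀ i, x i ∈ C.gr (a i)) (e : Coalgebra.comul (R := R) c = ∑ i, x i ⊗ₜ[R] y i) :
    C.cobarDLetter c = - C.sinv (C.d c) +
      ∑ i, (-1 : R) ^ a i • (C.sinv (x i) * C.sinv (y i)) := by
  simp [cobarDLetter, e, sgn_of_mem C.gr (hx _)]

end ChainCoalg

namespace TwistingCochain

variable {R : Type u} [CommRing R] {C : ChainCoalg.{u, v} R} {A : ChainAlg.{u, w} R}
  (t : TwistingCochain C A)

theorem hochD_one_tmul (w : A.carrier) : t.hochD (C.one ⊗ₜ w) = C.one ⊗ₜ A.d w := by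
  simp [hochD, hochLeft, hochRight, C.comul_one, t.toLin_one, tensorD, C.d_one,
    sgn_of_mem C.gr C.one_mem]

theorem hochD_tmul {n q k : ℕ} {c : C.carrier} {w : A.carrier} (hc : c ∈ C.gr n)
    (hw : w ∈ par A.gr q) {a b : Fin k → ℕ} {x y : Fin k → C.carrier}
    (hx : ∀ i, x i ∈ C.gr (a i)) (hy : ∀ i, y i ∈ C.gr (b i))
    (e : Coalgebra.comul (R := R) c = ∑ i, x i ⊗ₜ[R] y i) :
    t.hochD (c ⊗ₜ w) = C.d c ⊗ₜ w + (-1 : R) ^ n • (c ⊗ₜ A.d w) -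
      ∑ i, (-1 : R) ^ a i • (x i ⊗ₜ (t.toLin (y i) * w)) +
      ∑ i, (-1 : R) ^ ((a i + 1) * (b i + q)) • (y i ⊗ₜ (w * t.toLin (x i))) := by
  have ht := fun i => mem_par_of_predGr (t.mem _ _ (hx i))
  have h1 : t.hochLeft (c ⊗ₜ w) = ∑ i, (-1 : R) ^ a i • (x i ⊗ₜ (t.toLin (y i) * w)) := by
    simp [hochLeft, e, TensorProduct.sum_tmul, sgn_of_mem C.gr (hx _), TensorProduct.smul_tmul']
  have h2 : t.hochRight (c ⊗ₜ w) =
      ∑ i, (-1 : R) ^ ((a i + 1) * (b i + q)) • (y i ⊗ₜ (w * t.toLin (x i))) := by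
    simp [hochRight, e, TensorProduct.sum_tmul, koszul_of_par A.gr C.gr (ht _) (mem_par (hy _)),
      koszul_of_par A.gr A.gr (ht _) hw, ← TensorProduct.smul_tmul', smul_smul, mul_add, pow_add]
  rw [hochD, LinearMap.add_apply, LinearMap.sub_apply, h1, h2,
    tensorD_tmul_of_par C.gr C.d A.d (mem_par hc)]

/-- The case of a single letter of `hochD_cyclicForm`. The terms of the quadratic part of the cobar
differential are the reduced terms of the Hochschild differential; the commutator comes from the
unreduced ones. -/
theorem hochD_cyclicForm_sinv {n q : ℕ} {c : C.carrier} {w : A.carrier} (hc : c ∈ C.gr (n + 1))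
    (hw : w ∈ par A.gr q) :
    t.hochD (t.cyclicForm (C.sinv c) w) = - t.cyclicForm (C.cobarDLetter c) w
      - (-1 : R) ^ n • t.cyclicForm (C.sinv c) (A.d w)
      - C.one ⊗ₜ (t.toLin c * w - (-1 : R) ^ (n * q) • (w * t.toLin c)) := by
  obtain ⟨k, a, b, x, y, hab, hx, hy, e⟩ := exists_sum_of_mem_tensorGr (C.comul_mem _ c hc)
  have hc0 : Coalgebra.counit (R := R) c = 0 := C.counit_of_pos _ n.succ_pos _ hc
  -- The counit vanishes in positive degrees, so only the terms with `a i = 0` (in `h1`) or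
  -- `b i = 0` (in `h2`) contribute, and their signs are known.
  have h1 : ∑ i, (-1 : R) ^ a i • Coalgebra.counit (R := R) (x i) • y i = c := by
    rw [← C.sum_counit_smul e]
    refine Finset.sum_congr rfl fun i _ => ?_
    rcases h : a i with _ | m
    · simp
    · have := hx i
      rw [h] at this
      simp [C.counit_of_pos _ m.succ_pos _ this]
  have h2 : ∑ i, (-1 : R) ^ ((a i + 1) * (b i + q)) • Coalgebra.counit (R := R) (y i) • x i =
      (-1 : R) ^ (n * q) • c := by
    conv_rhs => rw [← C.sum_smul_counit e, Finset.smul_sum]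
    refine Finset.sum_congr rfl fun i _ => ?_
    rcases h : b i with _ | m
    · have := hab i
      rw [h, add_zero] at this
      rw [this]
      congr 1
      apply neg_one_pow_congr_mod
      have : (n + 1 + 1) * (0 + q) = n * q + 2 * q := by ring
      omega
    · have := hy i
      rw [h] at this
      simp [C.counit_of_pos _ m.succ_pos _ this]
  have h3 : t.cyclicForm (C.cobarDLetter c) w = - (C.d c ⊗ₜ w) +
      ∑ i, (-1 : R) ^ a i • (x i ⊗ₜ (t.toLin (y i) * w)) - C.one ⊗ₜ (t.toLin c * w) -
      ∑ i, (-1 : R) ^ ((a i + 1) * (b i + q)) • (y i ⊗ₜ (w * t.toLin (x i))) +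
      (-1 : R) ^ (n * q) • (C.one ⊗ₜ (w * t.toLin c)) := by
    have hx' := fun i => C.sinv_mem_par (hx i)
    have hy' := fun i => C.sinv_mem_par (hy i)
    have e1 : C.one ⊗ₜ[R] (t.toLin c * w) = ∑ i, (-1 : R) ^ a i •
        Coalgebra.counit (R := R) (x i) • (C.one ⊗ₜ[R] (t.toLin (y i) * w)) := by
      conv_lhs => rw [← h1]
      simp [Finset.sum_mul, TensorProduct.tmul_sum]
    have e2 : (-1 : R) ^ (n * q) • (C.one ⊗ₜ[R] (w * t.toLin c)) =
        ∑ i, (-1 : R) ^ ((a i + 1) * (b i + q)) • Coalgebra.counit (R := R) (y i) •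
          (C.one ⊗ₜ[R] (w * t.toLin (x i))) := by
      rw [← TensorProduct.tmul_smul, ← mul_smul_comm, ← map_smul, ← h2]
      simp [Finset.mul_sum, TensorProduct.tmul_sum]
    rw [C.cobarDLetter_eq_sum hx e, e1, e2]
    simp only [map_add, map_neg, map_sum, map_smul, LinearMap.add_apply, LinearMap.neg_apply,
      LinearMap.sum_apply, LinearMap.smul_apply, t.cyclicForm_mul (hx' _) (hy' _) hw,
      cyclicForm_sinv, wordMap_sinv, C.coe_toBar, C.counit_d, zero_smul, sub_zero,
      TensorProduct.sub_tmul, ← TensorProduct.smul_tmul', smul_sub, smul_add,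
      Finset.sum_add_distrib, Finset.sum_sub_distrib]
    have e3 : ∀ (i : Fin k) (z : C.carrier ⊗[R] A.carrier),
        (-1 : R) ^ a i • (-1 : R) ^ ((a i + 1) * (b i + 1 + q)) • z =
        - ((-1 : R) ^ ((a i + 1) * (b i + q)) • z) := by
      intro i z
      rw [smul_smul, ← pow_add, ← neg_smul,
        show -((-1 : R) ^ ((a i + 1) * (b i + q))) = (-1) ^ ((a i + 1) * (b i + q) + 1) by
          rw [pow_succ, mul_neg_one]]
      congr 1
      apply neg_one_pow_congr_mod
      have : a i + (a i + 1) * (b i + 1 + q) = (a i + 1) * (b i + q) + 1 + 2 * a i := by ring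
      omega
    simp only [e3, Finset.sum_neg_distrib]
    abel
  rw [h3, cyclicForm_sinv, cyclicForm_sinv, C.coe_toBar, hc0, zero_smul, sub_zero,
    t.hochD_tmul hc hw hx hy e, TensorProduct.tmul_sub, TensorProduct.tmul_smul, pow_succ]
  simp only [mul_neg, mul_one, neg_smul]
  abel

/-- The Hochschild differential maps `du · b` to `- d(∂u) · b ∓ du · ∂b - 1 ⊗ [u, b]`. -/
theorem hochD_cyclicForm {n : ℕ} {u : TensorAlgebra R C.bar} (hu : u ∈ wordGr C.desuspGr n)
    {q : ℕ} {b : A.carrier} (hb : b ∈ A.gr q) :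
    t.hochD (t.cyclicForm u b) = - t.cyclicForm (C.cobarD u) b
      - (-1 : R) ^ n • t.cyclicForm u (A.d b)
      - C.one ⊗ₜ (t.wordMap u * b - (-1 : R) ^ (n * q) • (b * t.wordMap u)) := by
  refine C.word_induction (P := fun n u => ∀ q : ℕ, ∀ b ∈ A.gr q,
    t.hochD (t.cyclicForm u b) = - t.cyclicForm (C.cobarD u) b
      - (-1 : R) ^ n • t.cyclicForm u (A.d b)
      - C.one ⊗ₜ (t.wordMap u * b - (-1 : R) ^ (n * q) • (b * t.wordMap u)))
    ?_ ?_ ?_ ?_ ?_ hu q b hb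
  · intro q b hb
    simp [cyclicForm_one, ChainCoalg.cobarD, oddDer_one]
  · intro m n c v hc hv ih q b hb
    have hx := mem_par (C.sinv_mem_of_mem hc)
    have hX : t.toLin c ∈ A.gr m := t.mem _ c hc
    have hv' := mem_par hv
    have hV := t.wordMap_mem hv
    have hb' := mem_par hb
    have hdx := d_mem_par C.cobarD_mem hx
    have hdv := d_mem_par C.cobarD_mem hv'
    have hdb := d_mem_par A.d_mem hb'
    have ih := ih (q + m) (b * t.toLin c) (SetLike.mul_mem_graded hb hX)
    have hl := t.hochD_cyclicForm_sinv hc (mul_mem_par A.gr (mem_par hV) hb')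
    rw [C.cobarD_mul, sgn_of_par _ hx, smul_mul_assoc, map_add, map_smul, LinearMap.add_apply,
      LinearMap.smul_apply, t.cyclicForm_mul hx hv' hb', t.cyclicForm_mul hx hv' hdb,
      t.cyclicForm_mul hdx hv' hb', t.cyclicForm_mul hx hdv hb', map_add, map_smul, wordMap_sinv,
      hl, ih, map_mul t.wordMap, wordMap_sinv, wordMap_cobarD, wordMap_cobarD, C.cobarD_sinv,
      wordMap_sinv, A.d_mul_of_par (mem_par hV), A.d_mul_of_par hb']
    simp only [map_add, map_smul, TensorProduct.tmul_sub, TensorProduct.tmul_smul, smul_add,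
      smul_sub, smul_neg, smul_smul, mul_assoc]
    rcases neg_one_pow_eq_or R m with hm | hm <;> rcases neg_one_pow_eq_or R n with hn | hn <;>
    rcases neg_one_pow_eq_or R q with hq | hq <;>
    simp only [add_mul, mul_add, pow_add, pow_mul, hm, hn, hq, one_pow, one_mul, mul_one,
      mul_neg, neg_neg, neg_smul, one_smul] <;> abel
  · intro n q b _; simp
  · intro n u v hu hv q b hb
    simp only [map_add, LinearMap.add_apply, hu q b hb, hv q b hb, add_mul, mul_add, smul_add,
      TensorProduct.tmul_add, TensorProduct.tmul_sub]
    abel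
  · intro n r u hu q b hb
    simp only [map_smul, LinearMap.smul_apply, hu q b hb, smul_sub, smul_neg, smul_mul_assoc,
      mul_smul_comm, TensorProduct.tmul_smul, TensorProduct.tmul_sub, smul_comm _ r]

/-- The projection `Id ⊗ ε` of a cyclic one-form `du · b` depends on `b` only through `ε(b)`. -/
theorem proj_cyclicForm (ht : ∀ c, A.aug (t.toLin c) = 0) (u : TensorAlgebra R C.bar)
    (b : A.carrier) :
    TensorProduct.rid R C.carrier (TensorProduct.map LinearMap.id A.aug.toLinearMap
      (t.cyclicForm u b)) = A.aug b • TensorProduct.rid R C.carrier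
        (TensorProduct.map LinearMap.id A.aug.toLinearMap (t.cyclicForm u 1)) := by
  set π : C.carrier ⊗[R] A.carrier →ₗ[R] C.carrier := (TensorProduct.rid R C.carrier).toLinearMap ∘ₗ
    TensorProduct.map LinearMap.id A.aug.toLinearMap with hπ
  change π (t.cyclicForm u b) = A.aug b • π (t.cyclicForm u 1)
  refine LinearMap.congr_fun (f := π ∘ₗ t.cyclicForm.flip b)
    (g := A.aug b • (π ∘ₗ t.cyclicForm.flip 1)) ?_ u
  apply linearMap_ext_gr (wordGr C.desuspGr)
  intro n u hu
  simp only [LinearMap.comp_apply, LinearMap.smul_apply, LinearMap.flip_apply]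
  refine LinearMap.congr_fun (f := π ∘ₗ t.cyclicForm u)
    (g := A.aug.toLinearMap.smulRight (π (t.cyclicForm u 1))) ?_ b
  apply linearMap_ext_gr A.gr
  intro q b hb
  simp only [LinearMap.comp_apply, LinearMap.smulRight_apply, AlgHom.toLinearMap_apply]
  refine C.word_induction (P := fun n u => ∀ q : ℕ, ∀ b ∈ A.gr q, π (t.cyclicForm u b) =
    A.aug b • π (t.cyclicForm u 1)) ?_ ?_ ?_ ?_ ?_ hu q b hb
  · intro q b hb; simp [cyclicForm_one]
  · intro m n c u hc hu ih q b hb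
    have hx := mem_par (C.sinv_mem_of_mem hc)
    have hX : t.toLin c ∈ A.gr m := t.mem _ c hc
    rw [t.cyclicForm_mul hx (mem_par hu) (mem_par hb),
      t.cyclicForm_mul hx (mem_par hu) (one_mem_par A.gr), map_add, map_add, map_smul, map_smul,
      wordMap_sinv, ih _ _ (SetLike.mul_mem_graded hb hX), one_mul, ih _ _ hX, map_mul A.aug, ht]
    simp [hπ, cyclicForm_sinv, smul_smul, mul_comm]
  · intro n q b _; simp
  · intro n u v hu hv q b hb
    simp [hu q b hb, hv q b hb]
  · intro n r u hu q b hb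
    simp [hu q b hb, smul_comm r]

end TwistingCochain

/-! ### Naturality of cyclic one-forms -/

section Naturality

variable {R : Type u} [CommRing R] {C C' : ChainCoalg.{u, v} R} {A A' : ChainAlg.{u, w} R}
  (t : TwistingCochain C A) (t' : TwistingCochain C' A') (f : C.Hom C') (g : A.Hom A')

/-- The algebra map `Ω f`, with source and target written as tensor algebras. -/
def ChainCoalg.Hom.tensorMap : TensorAlgebra R C.bar →ₐ[R] TensorAlgebra R C'.bar :=
  TensorAlgebra.lift R (C'.sinv ∘ₗ f.toCoalgHom.toLinearMap ∘ₗ C.bar.subtype)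

theorem ChainCoalg.Hom.tensorMap_sinv (c : C.carrier) :
    f.tensorMap (C.sinv c) = C'.sinv (f.toCoalgHom c) := by
  simp [tensorMap, ChainCoalg.sinv, C.coe_toBar, f.map_one, C'.toBar_of_mem_zero C'.one_mem]

theorem ChainCoalg.Hom.tensorMap_mem {n : ℕ} {u : TensorAlgebra R C.bar}
    (hu : u ∈ wordGr C.desuspGr n) : f.tensorMap u ∈ wordGr C'.desuspGr n := by
  refine C.word_induction (P := fun n u => f.tensorMap u ∈ wordGr C'.desuspGr n) ?_ ?_ ?_ ?_ ?_ hu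
  · rw [_root_.map_one]; exact SetLike.GradedOne.one_mem (A := wordGr C'.desuspGr)
  · intro m n c u hc _ ih
    rw [map_mul, tensorMap_sinv]
    exact SetLike.mul_mem_graded (C'.sinv_mem_of_mem (f.mem _ c hc)) ih
  · intro n; rw [map_zero]; exact Submodule.zero_mem _
  · intro n u v hu hv; rw [map_add]; exact Submodule.add_mem _ hu hv
  · intro n r u hu; rw [map_smul]; exact Submodule.smul_mem _ _ hu

variable {t t' f g}

theorem map_wordMap (htw : ∀ c, g.toAlgHom (t.toLin c) = t'.toLin (f.toCoalgHom c))
    (u : TensorAlgebra R C.bar) : g.toAlgHom (t.wordMap u) = t'.wordMap (f.tensorMap u) := by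
  refine DFunLike.congr_fun (f := g.toAlgHom.comp t.wordMap) (g := t'.wordMap.comp f.tensorMap) ?_ u
  apply TensorAlgebra.hom_ext
  ext c
  simp only [LinearMap.comp_apply, AlgHom.toLinearMap_apply, AlgHom.comp_apply, C.ι_eq_sinv,
    f.tensorMap_sinv, TwistingCochain.wordMap_sinv, htw]

theorem map_cyclicForm (htw : ∀ c, g.toAlgHom (t.toLin c) = t'.toLin (f.toCoalgHom c))
    (u : TensorAlgebra R C.bar) (b : A.carrier) :
    TensorProduct.map f.toCoalgHom.toLinearMap g.toAlgHom.toLinearMap (t.cyclicForm u b) =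
      t'.cyclicForm (f.tensorMap u) (g.toAlgHom b) := by
  set φ := TensorProduct.map f.toCoalgHom.toLinearMap g.toAlgHom.toLinearMap with hφ
  refine LinearMap.congr_fun (f := φ ∘ₗ t.cyclicForm.flip b)
    (g := t'.cyclicForm.flip (g.toAlgHom b) ∘ₗ f.tensorMap.toLinearMap) ?_ u
  apply linearMap_ext_gr (wordGr C.desuspGr)
  intro n u hu
  refine LinearMap.congr_fun (f := φ ∘ₗ t.cyclicForm u)
    (g := t'.cyclicForm (f.tensorMap u) ∘ₗ g.toAlgHom.toLinearMap) ?_ b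
  apply linearMap_ext_gr A.gr
  intro q b hb
  refine C.word_induction (P := fun n u => ∀ q : ℕ, ∀ b ∈ A.gr q, φ (t.cyclicForm u b) =
    t'.cyclicForm (f.tensorMap u) (g.toAlgHom b)) ?_ ?_ ?_ ?_ ?_ hu q b hb
  · intro q b hb; simp [TwistingCochain.cyclicForm_one]
  · intro m n c u hc hu ih q b hb
    have hx := C.sinv_mem_of_mem hc
    have hX : t.toLin c ∈ A.gr m := t.mem _ c hc
    have hfx := C'.sinv_mem_of_mem (f.mem _ c hc)
    have hbar : f.toCoalgHom (C.toBar c) = C'.toBar (f.toCoalgHom c) := by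
      simp [C.coe_toBar, C'.coe_toBar, f.map_one]
    rw [t.cyclicForm_mul (mem_par hx) (mem_par hu) (mem_par hb), map_mul f.tensorMap,
      f.tensorMap_sinv,
      t'.cyclicForm_mul (mem_par hfx) (mem_par (f.tensorMap_mem hu)) (mem_par (g.mem _ _ hb)),
      map_add, map_smul, t.wordMap_sinv, ih _ _ (SetLike.mul_mem_graded hb hX), t'.wordMap_sinv,
      map_mul g.toAlgHom, htw, t.cyclicForm_sinv, t'.cyclicForm_sinv, hφ, TensorProduct.map_tmul]
    simp [map_wordMap htw, hbar]
  · intro n q b _; simp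
  · intro n u v hu hv q b hb
    simp [hu q b hb, hv q b hb]
  · intro n r u hu q b hb
    simp [hu q b hb]

end Naturality

/-! ### The lifted power map -/

/-- If `δ z` is symmetric, then the two factors of `δ z` may be exchanged, with Koszul sign, in any
linear expression; the sign `(-1)^{|z₁| p}` allows for passing `z₁` across something of degree `p`. -/
theorem HopfStr.sum_symm {R : Type u} [CommRing R] {A : ChainAlg.{u, v} R} (δ : HopfStr A)
    {M : Type*} [AddCommGroup M] [Module R M] (F : A.carrier ⊗[R] A.carrier →ₗ[R] M) (p : ℕ)
    {z : A.carrier} (hz : koszul A.gr A.gr (δ.comul z) = δ.comul z) {k : ℕ} {a b : Fin k → ℕ}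
    {x y : Fin k → A.carrier} (hx : ∀ i, x i ∈ A.gr (a i)) (hy : ∀ i, y i ∈ A.gr (b i))
    (e : δ.comul z = ∑ i, x i ⊗ₜ[R] y i) :
    ∑ i, (-1 : R) ^ (a i * p) • F (x i ⊗ₜ y i) =
      ∑ i, (-1 : R) ^ (a i * b i + b i * p) • F (y i ⊗ₜ x i) := by
  have h := congrArg
    (F ∘ₗ TensorProduct.map (sgn A.gr ^ p : Module.End R A.carrier) LinearMap.id) hz
  rw [e] at h
  simp only [LinearMap.comp_apply, map_sum, koszul_of_mem A.gr A.gr (hx _) (hy _), map_smul,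
    TensorProduct.map_tmul, sgn_pow_of_mem A.gr p (hx _), sgn_pow_of_mem A.gr p (hy _),
    LinearMap.id_apply, ← TensorProduct.smul_tmul', smul_smul, ← pow_add] at h
  simpa only [mul_comm p] using h.symm

namespace TwistingCochain

variable {R : Type u} [CommRing R] {C : ChainCoalg.{u, v} R} {A : ChainAlg.{u, w} R}
  (ψ : HopfStr C.cobar) (t : TwistingCochain C A) (δ : HopfStr A) (r : ℕ)

/-- The comultiplication `ψ`, with source and target written in terms of the tensor algebra. -/
def wordComul : TensorAlgebra R C.bar →ₗ[R] TensorAlgebra R C.bar ⊗[R] TensorAlgebra R C.bar :=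
  ψ.comul

theorem wordComul_mem {n : ℕ} {u : TensorAlgebra R C.bar} (hu : u ∈ wordGr C.desuspGr n) :
    wordComul ψ u ∈ tensorGr (wordGr C.desuspGr) (wordGr C.desuspGr) n := ψ.comul_mem n u hu

theorem wordComul_cobarD (u : TensorAlgebra R C.bar) : wordComul ψ (C.cobarD u) =
    tensorD (wordGr C.desuspGr) C.cobarD C.cobarD (wordComul ψ u) := ψ.comul_d u

theorem wordComul_mul {u v : TensorAlgebra R C.bar} {k l : ℕ} {b : Fin k → ℕ}
    {c : Fin l → ℕ} {x x' : Fin k → TensorAlgebra R C.bar} {y y' : Fin l → TensorAlgebra R C.bar}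
    (hx' : ∀ i, x' i ∈ wordGr C.desuspGr (b i)) (hy : ∀ j, y j ∈ wordGr C.desuspGr (c j))
    (eu : wordComul ψ u = ∑ i, x i ⊗ₜ x' i) (ev : wordComul ψ v = ∑ j, y j ⊗ₜ y' j) :
    wordComul ψ (u * v) =
      ∑ i, ∑ j, (-1 : R) ^ (b i * c j) • ((x i * y j) ⊗ₜ[R] (x' i * y' j)) := by
  let o := GradedTensorProduct.of R (wordGr C.desuspGr) (wordGr C.desuspGr)
  have h : o (wordComul ψ (u * v)) = o (wordComul ψ u) * o (wordComul ψ v) := ψ.comul_mul u v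
  apply o.injective
  rw [h, eu, ev]
  simp only [map_sum, Finset.sum_mul, Finset.mul_sum, map_smul]
  rw [Finset.sum_comm]
  refine Finset.sum_congr rfl fun i _ => Finset.sum_congr rfl fun j _ => ?_
  exact gradedTmul_mul (wordGr C.desuspGr) _ _ (mem_par (hx' i)) (mem_par (hy j))

/-- The map `(u₁ ⊗ u₂, w) ↦ du₁ · (∑ ± w₁ u₂₁ w₂ u₂₂ ⋯ w_{r+1})`. -/
def spread : TensorAlgebra R C.bar ⊗[R] TensorAlgebra R C.bar →ₗ[R]
    A.carrier →ₗ[R] C.carrier ⊗[R] A.carrier :=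
  TensorProduct.lift (LinearMap.mk₂ R
    (fun u₁ u₂ => t.cyclicForm u₁ ∘ₗ δ.interleave r (t.wordMap u₂))
    (fun u u' v => by ext; simp) (fun c u v => by ext; simp)
    (fun u v v' => by ext; simp) (fun c u v => by ext; simp))

@[simp]
theorem spread_tmul (u₁ u₂ : TensorAlgebra R C.bar) (w : A.carrier) :
    t.spread δ r (u₁ ⊗ₜ u₂) w = t.cyclicForm u₁ (δ.interleave r (t.wordMap u₂) w) := rfl

/-- The effect of the lifted power map `λ̃_{r+1}` on cyclic one-forms,
`du · w ↦ ∑ ± du₁ · (w₁ u₂ w₂ u₃ ⋯ u_{r+1} w_{r+1})`. -/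
def formPower : TensorAlgebra R C.bar →ₗ[R] A.carrier →ₗ[R] C.carrier ⊗[R] A.carrier :=
  t.spread δ r ∘ₗ wordComul ψ

/-- The lifted power map `λ̃_{r+1}` on `C ⊗ A`, which sends `1 ⊗ w` to `1 ⊗ λ_{r+1}(w)` and is
given by `formPower` on `c ⊗ w = d(s⁻¹ c) · w` for `c` in the coaugmentation coideal. -/
def liftedPower : C.carrier ⊗[R] A.carrier →ₗ[R] C.carrier ⊗[R] A.carrier :=
  TensorProduct.lift (t.formPower ψ δ r ∘ₗ C.sinv +
    (Coalgebra.counit (R := R) (A := C.carrier)).smulRight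
      (TensorProduct.mk R C.carrier A.carrier C.one ∘ₗ δ.power (r + 1)))

theorem liftedPower_tmul (c : C.carrier) (w : A.carrier) :
    t.liftedPower ψ δ r (c ⊗ₜ w) = t.formPower ψ δ r (C.sinv c) w +
      Coalgebra.counit (R := R) c • (C.one ⊗ₜ δ.power (r + 1) w) := rfl

theorem liftedPower_one_tmul (w : A.carrier) :
    t.liftedPower ψ δ r (C.one ⊗ₜ w) = C.one ⊗ₜ δ.power (r + 1) w := by
  simp [liftedPower_tmul, C.sinv_one, C.counit_one]

theorem liftedPower_cyclicForm_sinv (c : C.carrier) (w : A.carrier) :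
    t.liftedPower ψ δ r (t.cyclicForm (C.sinv c) w) = t.formPower ψ δ r (C.sinv c) w := by
  have h1 : Coalgebra.counit (R := R) (C.toBar c : C.carrier) = 0 := (C.toBar c).2
  have h2 : C.sinv (C.toBar c : C.carrier) = C.sinv c := by simp [C.coe_toBar, C.sinv_one]
  rw [cyclicForm_sinv, liftedPower_tmul, h1, h2, zero_smul, add_zero]

theorem formPower_eq_sum {u : TensorAlgebra R C.bar} {k : ℕ}
    {x y : Fin k → TensorAlgebra R C.bar} (e : wordComul ψ u = ∑ i, x i ⊗ₜ y i) (w : A.carrier) :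
    t.formPower ψ δ r u w =
      ∑ i, t.cyclicForm (x i) (δ.interleave r (t.wordMap (y i)) w) := by
  simp [formPower, e]

theorem formPower_mem {n q : ℕ} {u : TensorAlgebra R C.bar} {w : A.carrier}
    (hu : u ∈ wordGr C.desuspGr n) (hw : w ∈ A.gr q) :
    t.formPower ψ δ r u w ∈ tensorGr C.gr A.gr (n + 1 + q) := by
  obtain ⟨k, a, b, x, y, hab, hx, hy, e⟩ := exists_sum_of_mem_tensorGr (wordComul_mem ψ hu)
  rw [t.formPower_eq_sum ψ δ r e]
  refine Submodule.sum_mem _ fun i _ => ?_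
  rw [show n + 1 + q = a i + 1 + (b i + q) by rw [← hab i]; ring]
  exact t.cyclicForm_mem (hx i) (δ.interleave_mem r (t.wordMap_mem (hy i)) hw)

theorem liftedPower_mem {n : ℕ} {z : C.carrier ⊗[R] A.carrier} (hz : z ∈ tensorGr C.gr A.gr n) :
    t.liftedPower ψ δ r z ∈ tensorGr C.gr A.gr n := by
  obtain ⟨k, a, b, x, y, hab, hx, hy, rfl⟩ := exists_sum_of_mem_tensorGr hz
  rw [map_sum]
  refine Submodule.sum_mem _ fun i _ => ?_
  have hx := hx i
  have hab := hab i
  rw [liftedPower_tmul]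
  rcases h : a i with _ | m
  · rw [h] at hx hab
    refine Submodule.add_mem _ ?_ (Submodule.smul_mem _ _
      (tmul_mem_tensorGr C.one_mem (δ.power_mem _ _ _ (hy i)) hab))
    simp [ChainCoalg.sinv, C.toBar_of_mem_zero hx]
  · rw [h] at hx hab
    rw [C.counit_of_pos _ m.succ_pos _ hx, zero_smul, add_zero, ← hab]
    exact t.formPower_mem ψ δ r (C.sinv_mem_of_mem hx) (hy i)

theorem proj_liftedPower (ht : ∀ c, A.aug (t.toLin c) = 0)
    (hα : ∀ u, A.aug (t.wordMap u) = TensorAlgebra.algebraMapInv u)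
    (z : C.carrier ⊗[R] A.carrier) :
    TensorProduct.rid R C.carrier (TensorProduct.map LinearMap.id A.aug.toLinearMap
      (t.liftedPower ψ δ r z)) = TensorProduct.rid R C.carrier
        (TensorProduct.map LinearMap.id A.aug.toLinearMap z) := by
  set π : C.carrier ⊗[R] A.carrier →ₗ[R] C.carrier := (TensorProduct.rid R C.carrier).toLinearMap ∘ₗ
    TensorProduct.map LinearMap.id A.aug.toLinearMap with hπ
  refine LinearMap.congr_fun (f := π ∘ₗ t.liftedPower ψ δ r) (g := π) ?_ z
  apply TensorProduct.ext'
  intro c w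
  have h1 : ∀ u : TensorAlgebra R C.bar, ∀ w, π (t.formPower ψ δ r u w) =
      A.aug w • π (t.cyclicForm u 1) := by
    intro u w
    have e : TensorProduct.map LinearMap.id
        (TensorAlgebra.algebraMapInv (R := R) (M := C.bar)).toLinearMap
        (wordComul ψ u) = u ⊗ₜ 1 := ψ.comul_aug u
    -- By `proj_cyclicForm`, the second tensor factor only enters through its augmentation.
    have h2 : (π ∘ₗ LinearMap.applyₗ w) ∘ₗ t.spread δ r =
        A.aug w • ((π ∘ₗ t.cyclicForm.flip 1) ∘ₗ
        (TensorProduct.rid R (TensorAlgebra R C.bar)).toLinearMap ∘ₗ TensorProduct.map LinearMap.id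
        (TensorAlgebra.algebraMapInv (R := R) (M := C.bar)).toLinearMap) := by
      apply TensorProduct.ext'
      intro u v
      have := t.proj_cyclicForm ht u (δ.interleave r (t.wordMap v) w)
      rw [δ.aug_interleave, hα] at this
      simp only [LinearMap.comp_apply, LinearMap.applyₗ_apply_apply, spread_tmul,
        LinearMap.smul_apply, TensorProduct.map_tmul, LinearMap.id_apply, LinearEquiv.coe_coe,
        TensorProduct.rid_tmul, LinearMap.flip_apply, map_smul, AlgHom.toLinearMap_apply, smul_smul]
      rw [mul_comm (A.aug w)]
      exact this
    have h3 := LinearMap.congr_fun h2 (wordComul ψ u)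
    simp only [LinearMap.comp_apply, LinearMap.smul_apply, e] at h3
    simpa [formPower] using h3
  simp only [LinearMap.comp_apply, liftedPower_tmul, map_add, h1, map_smul, cyclicForm_sinv]
  simp [hπ, C.coe_toBar, smul_sub, smul_smul, δ.aug_power, mul_comm]

theorem liftedPower_of_primitive
    (h : ∀ c, ψ.comul (C.sinv c) = C.sinv c ⊗ₜ[R] 1 + 1 ⊗ₜ[R] C.sinv c) :
    t.liftedPower ψ δ r = TensorProduct.map LinearMap.id (δ.power (r + 1)) := by
  apply TensorProduct.ext'
  intro c w
  have h' : wordComul ψ (C.sinv c) = C.sinv c ⊗ₜ[R] 1 + 1 ⊗ₜ[R] C.sinv c := h c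
  rw [liftedPower_tmul, formPower, LinearMap.comp_apply, h', map_add, LinearMap.add_apply,
    spread_tmul, spread_tmul, cyclicForm_one, _root_.map_one, δ.interleave_one_left,
    cyclicForm_sinv, C.coe_toBar, TensorProduct.sub_tmul, TensorProduct.map_tmul,
    TensorProduct.smul_tmul', LinearMap.id_apply]
  abel

variable {ψ t δ}

theorem comul_wordMap (hα : ∀ u, TensorProduct.map t.wordMap.toLinearMap t.wordMap.toLinearMap
      (wordComul ψ u) = δ.comul (t.wordMap u)) {u : TensorAlgebra R C.bar} {k : ℕ}
    {x y : Fin k → TensorAlgebra R C.bar} (e : wordComul ψ u = ∑ i, x i ⊗ₜ y i) :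
    δ.comul (t.wordMap u) = ∑ i, t.wordMap (x i) ⊗ₜ t.wordMap (y i) := by
  rw [← hα, e]
  simp

/-- On quadratic words, the lifted power map of `du · w` is computed by `formPower`; this is where
the symmetry of `δ t` is used. -/
theorem liftedPower_cyclicForm_mul (hα : ∀ u, TensorProduct.map t.wordMap.toLinearMap
      t.wordMap.toLinearMap (wordComul ψ u) = δ.comul (t.wordMap u))
    (hs : ∀ c, koszul A.gr A.gr (δ.comul (t.toLin c)) = δ.comul (t.toLin c))
    {p m q : ℕ} {c c' : C.carrier} {w : A.carrier} (hc : c ∈ C.gr (p + 1))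
    (hc' : c' ∈ C.gr (m + 1)) (hw : w ∈ A.gr q) :
    t.liftedPower ψ δ r (t.cyclicForm (C.sinv c * C.sinv c') w) =
      t.formPower ψ δ r (C.sinv c * C.sinv c') w := by
  have hu := C.sinv_mem_of_mem hc
  have hv := C.sinv_mem_of_mem hc'
  obtain ⟨k, a, b, x, x', hab, hx, hx', eu⟩ := exists_sum_of_mem_tensorGr (wordComul_mem ψ hu)
  obtain ⟨l, f, g, y, y', hfg, hy, hy', ev⟩ := exists_sum_of_mem_tensorGr (wordComul_mem ψ hv)
  have eu' := comul_wordMap hα eu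
  have ev' := comul_wordMap hα ev
  rw [t.cyclicForm_mul (mem_par hu) (mem_par hv) (mem_par hw), map_add, map_smul,
    liftedPower_cyclicForm_sinv, liftedPower_cyclicForm_sinv, t.formPower_eq_sum ψ δ r eu,
    t.formPower_eq_sum ψ δ r ev]
  have e1 : ∀ i, δ.interleave r (t.wordMap (x' i)) (t.wordMap (C.sinv c') * w) = _ := fun i =>
    δ.interleave_mul_left r w (t.wordMap_mem (hx' i)) (fun j => t.wordMap_mem (hy j)) ev'
  have e2 : ∀ j, t.cyclicForm (y j)
      (δ.interleave r (t.wordMap (y' j)) (w * t.wordMap (C.sinv c))) =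
      ∑ i, (-1 : R) ^ (a i * b i + b i * (g j + q)) • t.cyclicForm (y j)
        (δ.interleave r (t.wordMap (x' i) * t.wordMap (y' j)) w * t.wordMap (x i)) := by
    intro j
    rw [δ.interleave_mul_right r (t.wordMap_mem (hy' j)) hw (t.wordMap_mem hu) hab
      (fun i => t.wordMap_mem (hx i)) (fun i => t.wordMap_mem (hx' i)) eu', map_sum]
    -- The symmetry applies because the first argument of `interleave` was exposed together with the
    -- right factor in `interleave_mul_right`.
    have := δ.sum_symm (t.cyclicForm (y j) ∘ₗ LinearMap.mul' R A.carrier ∘ₗ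
      TensorProduct.map ((δ.interleave r).flip w ∘ₗ LinearMap.mulRight R (t.wordMap (y' j)))
        LinearMap.id) (g j + q) (z := t.wordMap (C.sinv c)) (by rw [wordMap_sinv, hs])
      (fun i => t.wordMap_mem (hx i)) (fun i => t.wordMap_mem (hx' i)) eu'
    simpa using this
  have e3 : t.formPower ψ δ r (C.sinv c * C.sinv c') w = ∑ i, ∑ j, (-1 : R) ^ (b i * f j) •
      (t.cyclicForm (x i) (t.wordMap (y j) *
          δ.interleave r (t.wordMap (x' i) * t.wordMap (y' j)) w) +
        (-1 : R) ^ (a i * (f j + (b i + g j + q))) • t.cyclicForm (y j)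
          (δ.interleave r (t.wordMap (x' i) * t.wordMap (y' j)) w * t.wordMap (x i))) := by
    rw [formPower, LinearMap.comp_apply, wordComul_mul ψ hx' hy eu ev]
    simp only [map_sum, LinearMap.sum_apply, map_smul, LinearMap.smul_apply, spread_tmul,
      map_mul t.wordMap]
    refine Finset.sum_congr rfl fun i _ => Finset.sum_congr rfl fun j _ => ?_
    rw [t.cyclicForm_mul (mem_par (hx i)) (mem_par (hy j)) (mem_par (δ.interleave_mem r
      (SetLike.mul_mem_graded (t.wordMap_mem (hx' i)) (t.wordMap_mem (hy' j))) hw))]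
  rw [e3]
  simp only [e1, e2, smul_add, Finset.sum_add_distrib, map_sum, map_smul, Finset.smul_sum]
  congr 1
  rw [Finset.sum_comm]
  refine Finset.sum_congr rfl fun i _ => Finset.sum_congr rfl fun j _ => ?_
  rw [smul_smul, smul_smul, ← pow_add, ← pow_add]
  congr 1
  apply neg_one_pow_congr_mod
  rw [← hab i, ← hfg j]
  have : (a i + b i) * (f j + g j + q) + (a i * b i + b i * (g j + q)) =
    b i * f j + a i * (f j + (b i + g j + q)) + 2 * (b i * (g j + q)) := by ring
  omega

/-- The Hochschild differential of `formPower`. By the symmetry of `δ t`, the terms in `1 ⊗ A`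
add up to the power map of a commutator. -/
theorem hochD_formPower (hα : ∀ u, TensorProduct.map t.wordMap.toLinearMap
      t.wordMap.toLinearMap (wordComul ψ u) = δ.comul (t.wordMap u))
    (hs : ∀ c, koszul A.gr A.gr (δ.comul (t.toLin c)) = δ.comul (t.toLin c))
    {p q : ℕ} {c : C.carrier} {w : A.carrier} (hc : c ∈ C.gr (p + 1)) (hw : w ∈ A.gr q) :
    t.hochD (t.formPower ψ δ r (C.sinv c) w) = - t.formPower ψ δ r (C.cobarD (C.sinv c)) w
      - (-1 : R) ^ p • t.formPower ψ δ r (C.sinv c) (A.d w)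
      - C.one ⊗ₜ (δ.power (r + 1) (t.wordMap (C.sinv c) * w
        - (-1 : R) ^ (p * q) • (w * t.wordMap (C.sinv c)))) := by
  have hu := C.sinv_mem_of_mem hc
  obtain ⟨k, a, b, x, x', hab, hx, hx', eu⟩ := exists_sum_of_mem_tensorGr (wordComul_mem ψ hu)
  have eu' := comul_wordMap hα eu
  have e1 : δ.power (r + 1) (t.wordMap (C.sinv c) * w) =
      ∑ i, t.wordMap (x i) * δ.interleave r (t.wordMap (x' i)) w := by
    rw [← δ.interleave_one_left, δ.interleave_mul_left r w
      (SetLike.GradedOne.one_mem (A := A.gr)) (fun j => t.wordMap_mem (hx j)) eu']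
    simp
  have e2 : (-1 : R) ^ (p * q) • δ.power (r + 1) (w * t.wordMap (C.sinv c)) =
      ∑ i, (-1 : R) ^ (a i * (b i + q)) •
        (δ.interleave r (t.wordMap (x' i)) w * t.wordMap (x i)) := by
    rw [← δ.interleave_one_left, δ.interleave_mul_right r
      (SetLike.GradedOne.one_mem (A := A.gr)) hw (t.wordMap_mem hu) hab
      (fun i => t.wordMap_mem (hx i)) (fun i => t.wordMap_mem (hx' i)) eu']
    have := δ.sum_symm (LinearMap.mul' R A.carrier ∘ₗ
      TensorProduct.map ((δ.interleave r).flip w) LinearMap.id) (0 + q)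
      (z := t.wordMap (C.sinv c)) (by rw [wordMap_sinv, hs])
      (fun i => t.wordMap_mem (hx i)) (fun i => t.wordMap_mem (hx' i)) eu'
    simp only [LinearMap.comp_apply, TensorProduct.map_tmul, LinearMap.flip_apply,
      LinearMap.id_apply, LinearMap.mul'_apply] at this
    simp only [mul_one, this, Finset.smul_sum]
    refine Finset.sum_congr rfl fun i _ => ?_
    rw [smul_smul, ← pow_add]
    congr 1
    apply neg_one_pow_congr_mod
    rw [← hab i]
    have : (a i + b i) * q + (a i * b i + b i * (0 + q)) = a i * (b i + q) + 2 * (b i * q) := by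
      ring
    omega
  have e3 : t.formPower ψ δ r (C.cobarD (C.sinv c)) w = ∑ i,
      (t.cyclicForm (C.cobarD (x i)) (δ.interleave r (t.wordMap (x' i)) w) +
        (-1 : R) ^ a i • t.cyclicForm (x i) (δ.interleave r (A.d (t.wordMap (x' i))) w)) := by
    rw [formPower, LinearMap.comp_apply, wordComul_cobarD, eu, map_sum, map_sum,
      LinearMap.sum_apply]
    refine Finset.sum_congr rfl fun i _ => ?_
    rw [tensorD_tmul_of_par _ _ _ (mem_par (hx i)), map_add, map_smul, LinearMap.add_apply,
      LinearMap.smul_apply, spread_tmul, spread_tmul, wordMap_cobarD]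
  rw [map_sub, map_smul, e1, e2, e3, t.formPower_eq_sum ψ δ r eu, t.formPower_eq_sum ψ δ r eu,
    TensorProduct.tmul_sub, TensorProduct.tmul_sum, TensorProduct.tmul_sum, map_sum,
    Finset.smul_sum, ← Finset.sum_neg_distrib, ← Finset.sum_sub_distrib, ← Finset.sum_sub_distrib,
    ← Finset.sum_sub_distrib]
  refine Finset.sum_congr rfl fun i _ => ?_
  rw [t.hochD_cyclicForm (hx i) (δ.interleave_mem r (t.wordMap_mem (hx' i)) hw),
    δ.d_interleave r (mem_par (t.wordMap_mem (hx' i))), map_add, map_smul, ← hab i, smul_add,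
    smul_smul, ← pow_add, TensorProduct.tmul_sub]
  abel

theorem liftedPower_hochD (hα : ∀ u, TensorProduct.map t.wordMap.toLinearMap
      t.wordMap.toLinearMap (wordComul ψ u) = δ.comul (t.wordMap u))
    (hs : ∀ c, koszul A.gr A.gr (δ.comul (t.toLin c)) = δ.comul (t.toLin c))
    (z : C.carrier ⊗[R] A.carrier) :
    t.liftedPower ψ δ r (t.hochD z) = t.hochD (t.liftedPower ψ δ r z) := by
  refine LinearMap.congr_fun (f := t.liftedPower ψ δ r ∘ₗ t.hochD)
    (g := t.hochD ∘ₗ t.liftedPower ψ δ r) ?_ z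
  apply tensor_ext_gr C.gr A.gr
  rintro (_ | n) q c hc w hw
  · rw [C.connected, Submodule.mem_span_singleton] at hc
    obtain ⟨s, rfl⟩ := hc
    simp [← TensorProduct.smul_tmul', hochD_one_tmul, liftedPower_one_tmul, δ.d_power]
  · have h0 : c ⊗ₜ[R] w = t.cyclicForm (C.sinv c) w := by
      rw [cyclicForm_sinv, C.coe_toBar, C.counit_of_pos _ n.succ_pos _ hc, zero_smul, sub_zero]
    have h1 : t.liftedPower ψ δ r (t.cyclicForm (C.cobarDLetter c) w) =
        t.formPower ψ δ r (C.cobarDLetter c) w := by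
      obtain ⟨k, a, b, x, y, hab, hx, hy, e⟩ := exists_sum_of_mem_tensorGr (C.comul_mem _ c hc)
      rw [C.cobarDLetter_eq_sum hx e]
      simp only [map_add, map_neg, map_sum, map_smul, LinearMap.add_apply, LinearMap.neg_apply,
        LinearMap.sum_apply, LinearMap.smul_apply, liftedPower_cyclicForm_sinv]
      congr 1
      refine Finset.sum_congr rfl fun i _ => ?_
      have hx := hx i
      have hy := hy i
      -- The letters `s⁻¹ c` with `c` of degree `0` vanish.
      rcases ha : a i with _ | m
      · rw [ha] at hx
        simp [ChainCoalg.sinv, C.toBar_of_mem_zero hx]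
      rcases hb : b i with _ | m'
      · rw [hb] at hy
        simp [ChainCoalg.sinv, C.toBar_of_mem_zero hy]
      rw [ha] at hx
      rw [hb] at hy
      rw [liftedPower_cyclicForm_mul r hα hs hx hy hw]
    rw [LinearMap.comp_apply, LinearMap.comp_apply, h0, liftedPower_cyclicForm_sinv,
      hochD_formPower r hα hs hc hw, t.hochD_cyclicForm (C.sinv_mem_of_mem hc) hw, C.cobarD_sinv,
      map_sub, map_sub, map_neg, map_smul, h1, liftedPower_cyclicForm_sinv, liftedPower_one_tmul]

end TwistingCochain

theorem map_liftedPower {R : Type u} [CommRing R] {C C' : ChainCoalg.{u, v} R}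
    {A A' : ChainAlg.{u, w} R} {t : TwistingCochain C A} {t' : TwistingCochain C' A'}
    {f : C.Hom C'} {g : A.Hom A'} (ψ : HopfStr C.cobar) (ψ' : HopfStr C'.cobar) (δ : HopfStr A)
    (δ' : HopfStr A') (r : ℕ) (htw : ∀ c, g.toAlgHom (t.toLin c) = t'.toLin (f.toCoalgHom c))
    (hψ : ∀ u, TensorProduct.map f.tensorMap.toLinearMap f.tensorMap.toLinearMap
      (TwistingCochain.wordComul ψ u) = TwistingCochain.wordComul ψ' (f.tensorMap u))
    (hδ : ∀ x, TensorProduct.map g.toAlgHom.toLinearMap g.toAlgHom.toLinearMap (δ.comul x) =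
      δ'.comul (g.toAlgHom x)) (z : C.carrier ⊗[R] A.carrier) :
    TensorProduct.map f.toCoalgHom.toLinearMap g.toAlgHom.toLinearMap (t.liftedPower ψ δ r z) =
      t'.liftedPower ψ' δ' r
        (TensorProduct.map f.toCoalgHom.toLinearMap g.toAlgHom.toLinearMap z) := by
  set φ := TensorProduct.map f.toCoalgHom.toLinearMap g.toAlgHom.toLinearMap
  have hφt : ∀ c w, φ (c ⊗ₜ w) = f.toCoalgHom c ⊗ₜ g.toAlgHom w := fun _ _ => rfl
  have hφf : ∀ u b, φ (t.cyclicForm u b) = t'.cyclicForm (f.tensorMap u) (g.toAlgHom b) :=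
    map_cyclicForm htw
  have h1 : ∀ u w, φ (t.formPower ψ δ r u w) =
      t'.formPower ψ' δ' r (f.tensorMap u) (g.toAlgHom w) := by
    intro u w
    have h2 : (φ ∘ₗ LinearMap.applyₗ w) ∘ₗ t.spread δ r =
        LinearMap.applyₗ (g.toAlgHom w) ∘ₗ t'.spread δ' r ∘ₗ
          TensorProduct.map f.tensorMap.toLinearMap f.tensorMap.toLinearMap := by
      apply TensorProduct.ext'
      intro u v
      simp [hφf, δ.map_interleave δ' g hδ, map_wordMap htw]
    have h3 := LinearMap.congr_fun h2 (TwistingCochain.wordComul ψ u)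
    simp only [LinearMap.comp_apply, hψ] at h3
    exact h3
  refine LinearMap.congr_fun (f := φ ∘ₗ t.liftedPower ψ δ r) (g := t'.liftedPower ψ' δ' r ∘ₗ φ) ?_ z
  apply TensorProduct.ext'
  intro c w
  have hε : Coalgebra.counit (R := R) (f.toCoalgHom c) = Coalgebra.counit (R := R) c :=
    CoalgHomClass.counit_comp_apply f.toCoalgHom c
  simp [TwistingCochain.liftedPower_tmul, h1, f.tensorMap_sinv, hφt, f.map_one, hε,
    δ.map_power δ' g hδ]

end PowerMap

end

theorem theorem3p1 {R : Type u} [CommRing R] [IsDomain R] [IsPrincipalIdealRing R]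
    (r : ℕ) (hr : 0 < r) :
    ∃ lam : ∀ X : PowerMap.TwistHH.{u, v, w} R, X.AlphaIsCoalgMap → X.IsSymm →
        (X.C.carrier ⊗[R] X.H.carrier →ₗ[R] X.C.carrier ⊗[R] X.H.carrier),
      (∀ (X : PowerMap.TwistHH.{u, v, w} R) (hα : X.AlphaIsCoalgMap) (hs : X.IsSymm),
        X.t.IsChainEnd (lam X hα hs) ∧
        (∀ h : X.H.carrier, lam X hα hs (X.C.one ⊗ₜ[R] h) = X.C.one ⊗ₜ[R] X.δ.power r h) ∧
        (∀ z, X.proj (lam X hα hs z) = X.proj z) ∧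
        (X.PrimitivelyGenerated →
          lam X hα hs = TensorProduct.map LinearMap.id (X.δ.power r))) ∧
      (∀ (X Y : PowerMap.TwistHH.{u, v, w} R) (hα : X.AlphaIsCoalgMap) (hs : X.IsSymm)
        (hα' : Y.AlphaIsCoalgMap) (hs' : Y.IsSymm) (φ : X.Hom Y) (z : X.C.carrier ⊗[R] X.H.carrier),
        TensorProduct.map φ.f.toCoalgHom.toLinearMap φ.g.toAlgHom.toLinearMap (lam X hα hs z) =
          lam Y hα' hs'
            (TensorProduct.map φ.f.toCoalgHom.toLinearMap φ.g.toAlgHom.toLinearMap z)) := by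
  obtain ⟨r, rfl⟩ : ∃ s, r = s + 1 := ⟨r - 1, by omega⟩
  refine ⟨fun X _ _ => X.t.liftedPower X.ψ X.δ r, ?_, ?_⟩
  · intro X hα hs
    have hε : ∀ u, X.H.aug (X.t.wordMap u) = TensorAlgebra.algebraMapInv u := hα.counit
    refine ⟨⟨fun n z hz => X.t.liftedPower_mem X.ψ X.δ r hz,
      PowerMap.TwistingCochain.liftedPower_hochD r hα.comul hs⟩,
      X.t.liftedPower_one_tmul X.ψ X.δ r, X.t.proj_liftedPower X.ψ X.δ r (fun c => ?_) hε,
      X.t.liftedPower_of_primitive X.ψ X.δ r⟩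
    rw [← X.t.wordMap_sinv, hε]
    simp [PowerMap.ChainCoalg.sinv, TensorAlgebra.algebraMapInv]
  · intro X Y _ _ _ _ φ z
    exact PowerMap.map_liftedPower X.ψ Y.ψ X.δ Y.δ r φ.twist φ.loop φ.hopf z
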